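/- Let $n\ge 1$, let $\mathbb R^{n+1}_+=\{(x,y)\in\mathbb R^n\times\mathbb R: y>0\}$, and for $r>0$ let $S_r=\{(x,y)\in\mathbb R^{n+1}_+: |x|^2+y^2=r^2\}$. Let $\alpha>-1$ and let $u:\mathbb R^{n+1}_+\to\mathbb C$ be a twice continuously differentiable solution of $$D_\alpha u\equiv y^{-\alpha}\Big(\sum_{i=1}^n\frac{\partial^2u}{\partial x_i^2}+\frac{\partial^2u}{\partial y^2}-\frac{\alpha}{y}\frac{\partial u}{\partial y}\Big)=0\quad\text{in }\mathbb R^{n+1}_+ .$$ Suppose that $$\sup_{(x,y)\in S_r}|u(x,y)|=o(r^{\alpha+1})\quad\text{as } r\to\infty,$$ and that $\lim_{y\to0^+}u_y=0$ in the space $\mathscr S'(\mathbb R^n)$ of tempered distributions, where $u_y(x)=u(x,y)$; here $u_y$ is regarded, for all sufficiently small $y>0$, as a tempered distribution, and the limit is tested on each Schwartz function. Then $u=0$ in $\mathbb R^{n+1}_+$. -/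

import Mathlib

open Filter Topology MeasureTheory
open scoped ENNReal SchwartzMap

namespace HalfSpace

/-- The open upper half space `{(x, y) ∈ ℝⁿ × ℝ : y > 0}`. -/
def upper (n : ℕ) : Set (EuclideanSpace ℝ (Fin n) × ℝ) :=
  {p | 0 < p.2}

/-- The open hemisphere `{(x, y) : y > 0, |x|² + y² = r²}`, with `|x|` the Euclidean norm. -/
def hemisphere (n : ℕ) (r : ℝ) : Set (EuclideanSpace ℝ (Fin n) × ℝ) :=
  upper n ∩ {p | ‖p.1‖ ^ 2 + p.2 ^ 2 = r ^ 2}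

/-- The partial derivative `∂u/∂xᵢ`. -/
noncomputable def partialX {n : ℕ} (i : Fin n) (u : EuclideanSpace ℝ (Fin n) × ℝ → ℂ)
    (p : EuclideanSpace ℝ (Fin n) × ℝ) : ℂ :=
  lineDeriv ℝ u p (EuclideanSpace.single i (1 : ℝ), (0 : ℝ))

/-- The partial derivative `∂u/∂y`. -/
noncomputable def partialY {n : ℕ} (u : EuclideanSpace ℝ (Fin n) × ℝ → ℂ)
    (p : EuclideanSpace ℝ (Fin n) × ℝ) : ℂ :=
  lineDeriv ℝ u p ((0 : EuclideanSpace ℝ (Fin n)), (1 : ℝ))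

/-- The operator `D_α u = y^(-α) (∑ᵢ ∂²u/∂xᵢ² + ∂²u/∂y² - (α / y) ∂u/∂y)`. -/
noncomputable def opD {n : ℕ} (α : ℝ) (u : EuclideanSpace ℝ (Fin n) × ℝ → ℂ)
    (p : EuclideanSpace ℝ (Fin n) × ℝ) : ℂ :=
  ((p.2 ^ (-α) : ℝ) : ℂ) *
    ((∑ i : Fin n, partialX i (partialX i u) p) + partialY (partialY u) p
      - ((α / p.2 : ℝ) : ℂ) * partialY u p)

/-- `u` is a (classical, twice continuously differentiable) solution of `D_α u = 0` in the
upper half space. Values of `u` outside the half space are irrelevant. -/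
def IsSolution {n : ℕ} (α : ℝ) (u : EuclideanSpace ℝ (Fin n) × ℝ → ℂ) : Prop :=
  ContDiffOn ℝ 2 u (upper n) ∧ ∀ p ∈ upper n, opD α u p = 0

/-- The supremum of `|u|` over the hemisphere of radius `r`, as a number in `[0, ∞]`. -/
noncomputable def supHemisphere {n : ℕ} (u : EuclideanSpace ℝ (Fin n) × ℝ → ℂ) (r : ℝ) : ℝ≥0∞ :=
  ⨆ p ∈ hemisphere n r, ‖u p‖ₑ

/-- `sup_{S_r} |u| = o(r^s)` as `r → ∞`. In particular the supremum is finite for large `r`. -/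
def SupIsLittleO {n : ℕ} (u : EuclideanSpace ℝ (Fin n) × ℝ → ℂ) (s : ℝ) : Prop :=
  Tendsto (fun r : ℝ => supHemisphere u r / ENNReal.ofReal (r ^ s)) atTop (𝓝 0)

/-- The tempered distribution `T` is the distribution defined by the locally integrable
function `g`, that is, `⟨T, φ⟩ = ∫ φ g` for all test functions `φ ∈ C₀^∞(ℝⁿ)`. As `C₀^∞` is
dense in the Schwartz space, `T` is determined by `g`. -/
def IsGivenBy {n : ℕ} (T : 𝓢'(EuclideanSpace ℝ (Fin n), ℂ))
    (g : EuclideanSpace ℝ (Fin n) → ℂ) : Prop :=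
  LocallyIntegrable g ∧
    ∀ φ : 𝓢(EuclideanSpace ℝ (Fin n), ℂ), HasCompactSupport φ → T φ = ∫ x, φ x * g x

/-- `lim_{y → 0+} u_y = f` in the space of tempered distributions on `ℝⁿ` (convergence tested
on each Schwartz function), where `u_y(x) = u(x, y)`. -/
def HasBoundaryLimit {n : ℕ} (u : EuclideanSpace ℝ (Fin n) × ℝ → ℂ)
    (f : 𝓢'(EuclideanSpace ℝ (Fin n), ℂ)) : Prop :=
  ∃ T : ℝ → 𝓢'(EuclideanSpace ℝ (Fin n), ℂ),
    (∀ᶠ y in 𝓝[>] (0 : ℝ), IsGivenBy (T y) (fun x => u (x, y))) ∧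
      Tendsto T (𝓝[>] 0) (𝓝 f)

end HalfSpace

/-! Convolve `u` in `x` with a test function `φ`. The coefficients of `L = Δ - (α/y) ∂_y` depend
only on `y`, so the mollified function is again a solution, and its tangential derivatives are
mollifications of `u` by derivatives of `φ`. It is still `o(r^(α+1))`.

The distributional boundary condition becomes a classical one. The uniform boundedness principle
bounds `mollify φ u` locally near `y = 0` (`exists_bound_sequence`). The same bound for the
derivatives of `φ` makes the slices uniformly Lipschitz, and each vertical limit is zero, so
`mollify φ u` extends continuously by zero to the boundary (`continuousOn_mollify_closed`).

For such solutions a Bernstein argument with the maximum principle (`bernstein_estimate`) bounds a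
tangential derivative on a half ball of radius `R` by a constant times `1/R` times the supremum of
the solution on the half ball of radius `3R`. Tangential derivatives of order `N > α + 1` are
therefore `O(R^(α+1-N))` and vanish identically.

The order is then lowered one step at a time. If all first tangential derivatives of a mollified
solution vanish, it depends on `y` only and solves `v'' = (α/y) v'`, so `v = d + c y^(α+1)/(α+1)`.
The boundary value gives `d = 0` and the growth gives `c = 0` (`mollify_eq_zero_of_testDeriv`). At
order zero `mollify φ u = 0` for every `φ`, hence `u = 0`. -/

namespace HalfSpace

/-! ### Pure second derivatives along a direction and the second derivative test. -/

section SecondDerivatives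

variable {P : Type*} [NormedAddCommGroup P] [NormedSpace ℝ P]
  {F : Type*} [NormedAddCommGroup F] [NormedSpace ℝ F]

/-- On `s`, the first and second derivatives of `f` in the direction `v` are `f'` and `f''`. -/
structure HasTwoLineDerivs (s : Set P) (v : P) (f f' f'' : P → F) : Prop where
  fst : ∀ p ∈ s, HasLineDerivAt ℝ f (f' p) p v
  snd : ∀ p ∈ s, HasLineDerivAt ℝ f' (f'' p) p v

namespace HasTwoLineDerivs

variable {s : Set P} {v : P}

theorem mono {t : Set P} {f f' f'' : P → F} (h : HasTwoLineDerivs s v f f' f'') (hts : t ⊆ s) :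
    HasTwoLineDerivs t v f f' f'' :=
  ⟨fun p hp => h.fst p (hts hp), fun p hp => h.snd p (hts hp)⟩

theorem add {f f' f'' g g' g'' : P → F} (hf : HasTwoLineDerivs s v f f' f'')
    (hg : HasTwoLineDerivs s v g g' g'') :
    HasTwoLineDerivs s v (fun p => f p + g p) (fun p => f' p + g' p) (fun p => f'' p + g'' p) :=
  ⟨fun p hp => HasDerivAt.fun_add (hf.fst p hp) (hg.fst p hp),
    fun p hp => HasDerivAt.fun_add (hf.snd p hp) (hg.snd p hp)⟩

theorem const (c : F) : HasTwoLineDerivs s v (fun _ => c) (fun _ => 0) (fun _ => 0) :=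
  ⟨fun _ _ => hasDerivAt_const _ _, fun _ _ => hasDerivAt_const _ _⟩

theorem clm_comp {G : Type*} [NormedAddCommGroup G] [NormedSpace ℝ G] (l : F →L[ℝ] G)
    {f f' f'' : P → F} (hf : HasTwoLineDerivs s v f f' f'') :
    HasTwoLineDerivs s v (fun p => l (f p)) (fun p => l (f' p)) (fun p => l (f'' p)) :=
  ⟨fun p hp => l.hasFDerivAt.comp_hasDerivAt (0 : ℝ) (hf.fst p hp),
    fun p hp => l.hasFDerivAt.comp_hasDerivAt (0 : ℝ) (hf.snd p hp)⟩

theorem mul {f f' f'' g g' g'' : P → ℝ} (hf : HasTwoLineDerivs s v f f' f'')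
    (hg : HasTwoLineDerivs s v g g' g'') :
    HasTwoLineDerivs s v (fun p => f p * g p) (fun p => f' p * g p + f p * g' p)
      (fun p => f'' p * g p + 2 * (f' p * g' p) + f p * g'' p) := by
  refine ⟨fun p hp => ?_, fun p hp => ?_⟩
  · have := HasDerivAt.fun_mul (hf.fst p hp) (hg.fst p hp)
    simpa [HasLineDerivAt] using this
  · have := HasDerivAt.fun_add (HasDerivAt.fun_mul (hf.snd p hp) (hg.fst p hp))
      (HasDerivAt.fun_mul (hf.fst p hp) (hg.snd p hp))
    refine HasDerivAt.congr_deriv this ?_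
    simp only [zero_smul, add_zero]
    ring

theorem const_mul {f f' f'' : P → ℝ} (c : ℝ) (hf : HasTwoLineDerivs s v f f' f'') :
    HasTwoLineDerivs s v (fun p => c * f p) (fun p => c * f' p) (fun p => c * f'' p) :=
  ⟨fun p hp => HasDerivAt.const_mul c (hf.fst p hp),
    fun p hp => HasDerivAt.const_mul c (hf.snd p hp)⟩

/-- Building block for the cutoff: `|x - x₀|²` and `y²` are sums of such squares. -/
theorem sq_clm (l : P →L[ℝ] ℝ) (c : ℝ) :
    HasTwoLineDerivs s v (fun p => (l p - c) ^ 2) (fun p => 2 * l v * (l p - c))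
      (fun _ => 2 * l v ^ 2) := by
  have h : ∀ p : P, HasDerivAt (fun t : ℝ => l (p + t • v) - c) (l v) 0 := by
    intro p
    have := ((hasDerivAt_id (0 : ℝ)).mul_const (l v)).const_add (l p - c)
    simp only [one_mul] at this
    refine this.congr_of_eventuallyEq (Eventually.of_forall fun t => ?_)
    simp only [map_add, map_smul, smul_eq_mul, id]
    ring
  refine ⟨fun p _ => ?_, fun p _ => ?_⟩
  · refine HasDerivAt.congr_deriv ((h p).fun_pow 2) ?_
    simp only [zero_smul, add_zero]
    push_cast
    ring
  · refine HasDerivAt.congr_deriv ((h p).const_mul (2 * l v)) ?_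
    ring

/-- The second derivative test at an interior maximum. -/
theorem nonpos_of_isLocalMax (hs : IsOpen s) {f f' f'' : P → ℝ}
    (hf : HasTwoLineDerivs s v f f' f'') {p : P} (hp : p ∈ s) (hmax : IsLocalMax f p) :
    f' p = 0 ∧ f'' p ≤ 0 := by
  have hline : ContinuousAt (fun t : ℝ => p + t • v) 0 := by fun_prop
  have hl : Tendsto (fun t : ℝ => p + t • v) (𝓝 0) (𝓝 p) := by
    simpa [ContinuousAt] using hline
  have hmax' : IsLocalMax (fun t : ℝ => f (p + t • v)) 0 := by
    have := hl.eventually hmax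
    simpa [IsLocalMax, IsMaxFilter] using this
  have h0 : f' p = 0 := hmax'.hasDerivAt_eq_zero (hf.fst p hp)
  refine ⟨h0, ?_⟩
  by_contra! hpos
  have hd : ∀ t : ℝ, p + t • v ∈ s →
      HasDerivAt (fun t : ℝ => f (p + t • v)) (f' (p + t • v)) t := by
    intro t ht
    -- A line derivative is a derivative at parameter `0`. Writing that point as `t - t` lets the
    -- shift `r ↦ r - t` move it to parameter `t`.
    have h1 : HasDerivAt (fun r : ℝ => f (p + t • v + r • v)) (f' (p + t • v)) (t - t) := by
      rw [sub_self]
      exact hf.fst _ ht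
    have h2 := HasDerivAt.comp_sub_const t t h1
    refine h2.congr_of_eventuallyEq (Eventually.of_forall fun r => ?_)
    simp only [sub_smul]
    congr 1
    abel
  -- Since `f' p = 0` and `f'' p > 0`, `f'` is positive just to the right, so `f` increases strictly
  -- there, against maximality.
  have hpos' : ∀ᶠ t in 𝓝[>] (0 : ℝ), 0 < f' (p + t • v) := by
    have h1 := (hasDerivAt_iff_tendsto_slope.1 (hf.snd p hp)).eventually (lt_mem_nhds hpos)
    have h2 : ∀ᶠ t in 𝓝[>] (0 : ℝ), 0 < slope (fun t : ℝ => f' (p + t • v)) 0 t :=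
      h1.filter_mono (nhdsWithin_mono _ fun t ht => ne_of_gt ht)
    filter_upwards [h2, self_mem_nhdsWithin] with t ht (ht0 : 0 < t)
    simp only [slope, vsub_eq_sub, sub_zero, zero_smul, add_zero, h0, smul_eq_mul] at ht
    exact (mul_pos_iff_of_pos_left (inv_pos.2 ht0)).1 ht
  have hall : ∀ᶠ t in 𝓝[>] (0 : ℝ), 0 < f' (p + t • v) ∧ p + t • v ∈ s ∧
      f (p + t • v) ≤ f (p + (0 : ℝ) • v) :=
    hpos'.and (((hl.eventually (hs.mem_nhds hp)).and hmax').filter_mono nhdsWithin_le_nhds)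
  obtain ⟨ε, hε, hsub⟩ := mem_nhdsGT_iff_exists_Ioo_subset.1 hall
  have hε0 : (0 : ℝ) < ε := hε
  have hmono : StrictMonoOn (fun t : ℝ => f (p + t • v)) (Set.Icc 0 (ε / 2)) := by
    refine strictMonoOn_of_deriv_pos (convex_Icc _ _) ?_ ?_
    · intro t ht
      refine (hd t ?_).continuousAt.continuousWithinAt
      rcases ht.1.eq_or_lt with h | h
      · simpa [← h] using hp
      · exact (hsub ⟨h, by linarith [ht.2]⟩).2.1
    · intro t ht
      rw [interior_Icc] at ht
      have := hsub (show t ∈ Set.Ioo 0 ε from ⟨ht.1, by linarith [ht.2]⟩)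
      rw [(hd t this.2.1).deriv]
      exact this.1
  have h1 := hmono (Set.left_mem_Icc.2 (by linarith)) (Set.right_mem_Icc.2 (by linarith))
    (half_pos hε0)
  exact absurd (hsub (show ε / 2 ∈ Set.Ioo 0 ε from ⟨by linarith, by linarith⟩)).2.2 (not_le.2 h1)

end HasTwoLineDerivs

end SecondDerivatives

/-! ### Coordinate directions and derivatives of squared distances. -/

/-- The coordinate direction `∂/∂xᵢ`. -/
noncomputable def dirX {n : ℕ} (i : Fin n) : EuclideanSpace ℝ (Fin n) × ℝ :=
  (EuclideanSpace.single i (1 : ℝ), (0 : ℝ))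

/-- The coordinate direction `∂/∂y`. -/
noncomputable def dirY (n : ℕ) : EuclideanSpace ℝ (Fin n) × ℝ :=
  ((0 : EuclideanSpace ℝ (Fin n)), (1 : ℝ))

theorem isOpen_upper (n : ℕ) : IsOpen (upper n) := isOpen_lt continuous_const continuous_snd

/-- The coordinate functional `(x, y) ↦ xᵢ`. -/
noncomputable def coordX {n : ℕ} (i : Fin n) : EuclideanSpace ℝ (Fin n) × ℝ →L[ℝ] ℝ :=
  (EuclideanSpace.proj i).comp (ContinuousLinearMap.fst ℝ _ _)

@[simp] theorem coordX_apply {n : ℕ} (i : Fin n) (p : EuclideanSpace ℝ (Fin n) × ℝ) :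
    coordX i p = p.1 i := rfl

section Sum

variable {P : Type*} [NormedAddCommGroup P] [NormedSpace ℝ P]
  {F : Type*} [NormedAddCommGroup F] [NormedSpace ℝ F]

theorem HasTwoLineDerivs.sum {s : Set P} {v : P} {ι : Type*} (t : Finset ι)
    {f f' f'' : ι → P → F} (h : ∀ i ∈ t, HasTwoLineDerivs s v (f i) (f' i) (f'' i)) :
    HasTwoLineDerivs s v (fun p => ∑ i ∈ t, f i p) (fun p => ∑ i ∈ t, f' i p)
      (fun p => ∑ i ∈ t, f'' i p) :=
  ⟨fun p hp => HasDerivAt.fun_sum fun i hi => (h i hi).fst p hp,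
    fun p hp => HasDerivAt.fun_sum fun i hi => (h i hi).snd p hp⟩

end Sum

theorem hasTwoLineDerivs_normSq_dirX {n : ℕ} (s : Set (EuclideanSpace ℝ (Fin n) × ℝ))
    (x₀ : EuclideanSpace ℝ (Fin n)) (i : Fin n) :
    HasTwoLineDerivs s (dirX i) (fun p => ‖p.1 - x₀‖ ^ 2) (fun p => 2 * (p.1 i - x₀ i))
      (fun _ => 2) := by
  have h := HasTwoLineDerivs.sum (s := s) (v := dirX i) Finset.univ
    (fun j _ => HasTwoLineDerivs.sq_clm (coordX j) (x₀ j))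
  convert h using 2 with p p p
  · rw [EuclideanSpace.norm_sq_eq]
    simp
  · rw [Finset.sum_eq_single i] <;> simp +contextual [dirX]
  · rw [Finset.sum_eq_single i] <;> simp +contextual [dirX]

theorem hasTwoLineDerivs_normSq_dirY {n : ℕ} (s : Set (EuclideanSpace ℝ (Fin n) × ℝ))
    (x₀ : EuclideanSpace ℝ (Fin n)) :
    HasTwoLineDerivs s (dirY n) (fun p => ‖p.1 - x₀‖ ^ 2) (fun _ => 0) (fun _ => 0) := by
  have h := HasTwoLineDerivs.sum (s := s) (v := dirY n) Finset.univ
    (fun j _ => HasTwoLineDerivs.sq_clm (coordX j) (x₀ j))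
  convert h using 2 with p p p
  · rw [EuclideanSpace.norm_sq_eq]
    simp
  · simp [dirY]
  · simp [dirY]

theorem hasTwoLineDerivs_sndSq_dirX {n : ℕ} (s : Set (EuclideanSpace ℝ (Fin n) × ℝ))
    (i : Fin n) :
    HasTwoLineDerivs s (dirX i) (fun p => p.2 ^ 2) (fun _ => 0) (fun _ => 0) := by
  have h := HasTwoLineDerivs.sq_clm (s := s) (v := dirX i) (ContinuousLinearMap.snd ℝ _ ℝ) 0
  simpa [dirX] using h

theorem hasTwoLineDerivs_sndSq_dirY {n : ℕ} (s : Set (EuclideanSpace ℝ (Fin n) × ℝ)) :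
    HasTwoLineDerivs s (dirY n) (fun p => p.2 ^ 2) (fun p => 2 * p.2) (fun _ => 2) := by
  have h := HasTwoLineDerivs.sq_clm (s := s) (v := dirY n) (ContinuousLinearMap.snd ℝ _ ℝ) 0
  simpa [dirY] using h

/-! ### Maximum principle and Bernstein's gradient estimate. -/

/-- The weak maximum principle for `∑ ∂²/∂xᵢ² + ∂²/∂y² - (α / y) ∂/∂y`. -/
theorem weak_maximum_principle {n : ℕ} (hn : 1 ≤ n) (α : ℝ)
    {K Ω : Set (EuclideanSpace ℝ (Fin n) × ℝ)} (hK : IsCompact K) (hΩ : IsOpen Ω) (hΩK : Ω ⊆ K)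
    {w : EuclideanSpace ℝ (Fin n) × ℝ → ℝ} (hw : ContinuousOn w K)
    {wx wxx : Fin n → EuclideanSpace ℝ (Fin n) × ℝ → ℝ}
    {wy wyy : EuclideanSpace ℝ (Fin n) × ℝ → ℝ}
    (hx : ∀ i, HasTwoLineDerivs Ω (dirX i) w (wx i) (wxx i))
    (hy : HasTwoLineDerivs Ω (dirY n) w wy wyy)
    (hsub : ∀ p ∈ Ω, 0 ≤ ∑ i, wxx i p + wyy p - α / p.2 * wy p)
    {M : ℝ} (hM : ∀ p ∈ K \ Ω, w p ≤ M) : ∀ p ∈ Ω, w p ≤ M := by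
  intro p hp
  by_contra! hlt
  obtain ⟨B, hB⟩ := hK.exists_bound_of_continuousOn
    (f := fun q : EuclideanSpace ℝ (Fin n) × ℝ => ‖q.1‖ ^ 2) (by fun_prop)
  have hB0 : 0 ≤ B := (norm_nonneg _).trans (hB p (hΩK hp))
  obtain ⟨ε, hε, hεB⟩ : ∃ ε : ℝ, 0 < ε ∧ ε * B < w p - M := by
    refine ⟨(w p - M) / (2 * (B + 1)), by positivity [sub_pos.2 hlt], ?_⟩
    rw [div_mul_eq_mul_div, div_lt_iff₀ (by positivity)]
    nlinarith [sub_pos.2 hlt]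
  -- The perturbation `ε|x|²` makes the inequality strict, since `L` maps it to `2nε > 0`. It does
  -- not involve `y`, so the singular coefficient never acts on it; at the maximum the first
  -- `y`-derivative of `w` vanishes, so no bound on `α/y` is needed.
  obtain ⟨q, hqK, hq⟩ := hK.exists_isMaxOn ⟨p, hΩK hp⟩
    (f := fun q => w q + ε * ‖q.1 - 0‖ ^ 2) (by fun_prop)
  have hqΩ : q ∈ Ω := by
    by_contra hqΩ
    have h1 := hM q ⟨hqK, hqΩ⟩
    have h2 : w p + ε * ‖p.1 - 0‖ ^ 2 ≤ w q + ε * ‖q.1 - 0‖ ^ 2 := hq (hΩK hp)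
    have h3 := hB q hqK
    rw [Real.norm_of_nonneg (by positivity)] at h3
    simp only [sub_zero] at h2
    nlinarith [mul_le_mul_of_nonneg_left h3 hε.le, mul_nonneg hε.le (sq_nonneg ‖p.1‖)]
  have hloc : IsLocalMax (fun q => w q + ε * ‖q.1 - 0‖ ^ 2) q :=
    hq.isLocalMax (mem_of_superset (hΩ.mem_nhds hqΩ) hΩK)
  have hxi := fun i => (((hx i).add ((hasTwoLineDerivs_normSq_dirX Ω 0 i).const_mul
    ε)).nonpos_of_isLocalMax hΩ hqΩ hloc).2
  have hyq := (hy.add ((hasTwoLineDerivs_normSq_dirY Ω 0).const_mul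
    ε)).nonpos_of_isLocalMax hΩ hqΩ hloc
  have hsum : ∑ i, wxx i q ≤ ∑ _i : Fin n, -(ε * 2) :=
    Finset.sum_le_sum fun i _ => by linarith [hxi i]
  have hn' : (1 : ℝ) ≤ n := by exact_mod_cast hn
  have hs := hsub q hqΩ
  simp only [mul_zero, add_zero] at hyq
  rw [hyq.1] at hs
  simp only [Finset.sum_const, Finset.card_univ, Fintype.card_fin, nsmul_eq_mul] at hsum
  nlinarith [hyq.2]


/-- `f` solves `∑ ∂²f/∂xᵢ² + ∂²f/∂y² - (α / y) ∂f/∂y = 0` in the upper half space, and the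
listed functions are its pure first and second partial derivatives. -/
structure SolvesWith {n : ℕ} {F : Type*} [NormedAddCommGroup F] [NormedSpace ℝ F] (α : ℝ)
    (f : EuclideanSpace ℝ (Fin n) × ℝ → F)
    (fx fxx : Fin n → EuclideanSpace ℝ (Fin n) × ℝ → F)
    (fy fyy : EuclideanSpace ℝ (Fin n) × ℝ → F) : Prop where
  hx : ∀ i, HasTwoLineDerivs (upper n) (dirX i) f (fx i) (fxx i)
  hy : HasTwoLineDerivs (upper n) (dirY n) f fy fyy
  eq_zero : ∀ p ∈ upper n, ∑ i, fxx i p + fyy p - (α / p.2) • fy p = 0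

theorem SolvesWith.clm_comp {n : ℕ} {F G : Type*} [NormedAddCommGroup F] [NormedSpace ℝ F]
    [NormedAddCommGroup G] [NormedSpace ℝ G] (l : F →L[ℝ] G) {α : ℝ}
    {f : EuclideanSpace ℝ (Fin n) × ℝ → F} {fx fxx : Fin n → EuclideanSpace ℝ (Fin n) × ℝ → F}
    {fy fyy : EuclideanSpace ℝ (Fin n) × ℝ → F} (h : SolvesWith α f fx fxx fy fyy) :
    SolvesWith α (fun p => l (f p)) (fun i p => l (fx i p)) (fun i p => l (fxx i p))
      (fun p => l (fy p)) (fun p => l (fyy p)) := by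
  refine ⟨fun i => (h.hx i).clm_comp l, h.hy.clm_comp l, fun p hp => ?_⟩
  have := congrArg l (h.eq_zero p hp)
  simpa using this

/-- A constant for the interior-in-`x` gradient bound. -/
noncomputable def gradConst (n : ℕ) (α : ℝ) : ℝ := 12 + 2 * (n + 1) + 2 * |α|

theorem gradConst_pos (n : ℕ) (α : ℝ) : 0 < gradConst n α := by
  unfold gradConst
  positivity

/-- The right side is the second derivative of `(ηg)²` in one direction. The difference of the two
sides is `2(2η₁g + ηg₁)²`: the cross term is absorbed by completing the square. -/
theorem bernstein_direction (η η1 η2 g g1 g2 : ℝ) :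
    -6 * η1 ^ 2 * g ^ 2 + 2 * (η * η2) * g ^ 2 + 2 * η ^ 2 * (g * g2) ≤
      2 * (η1 * g + η * g1) ^ 2 + 2 * (η * g) * (η2 * g + 2 * (η1 * g1) + η * g2) := by
  nlinarith [sq_nonneg (2 * (η1 * g) + η * g1)]

/-- Bernstein's estimate for a tangential derivative `g = ∂f/∂xᵢ` of a solution `f`, when both
vanish continuously on the boundary of the half space. -/
theorem bernstein_estimate {n : ℕ} (hn : 1 ≤ n) {α : ℝ} (i₀ : Fin n)
    {f g : EuclideanSpace ℝ (Fin n) × ℝ → ℝ}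
    {fx fxx gx gxx : Fin n → EuclideanSpace ℝ (Fin n) × ℝ → ℝ}
    {fy fyy gy gyy : EuclideanSpace ℝ (Fin n) × ℝ → ℝ}
    (hf : SolvesWith α f fx fxx fy fyy) (hg : SolvesWith α g gx gxx gy gyy)
    (hfg : ∀ p ∈ upper n, fx i₀ p = g p)
    (hfc : ContinuousOn f {p | 0 ≤ p.2}) (hgc : ContinuousOn g {p | 0 ≤ p.2})
    (hf0 : ∀ x, f (x, 0) = 0) (hg0 : ∀ x, g (x, 0) = 0)
    (x₀ : EuclideanSpace ℝ (Fin n)) {s M : ℝ} (hs : 0 < s)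
    (hM : ∀ p : EuclideanSpace ℝ (Fin n) × ℝ, 0 < p.2 → s * (‖p.1 - x₀‖ ^ 2 + p.2 ^ 2) ≤ 1 →
      |f p| ≤ M)
    {p : EuclideanSpace ℝ (Fin n) × ℝ} (hp0 : 0 < p.2)
    (hp : s * (‖p.1 - x₀‖ ^ 2 + p.2 ^ 2) < 1) :
    ((1 - s * (‖p.1 - x₀‖ ^ 2 + p.2 ^ 2)) * g p) ^ 2 ≤ gradConst n α * s * M ^ 2 := by
  set K : Set (EuclideanSpace ℝ (Fin n) × ℝ) :=
    {p | 0 ≤ p.2 ∧ s * (‖p.1 - x₀‖ ^ 2 + p.2 ^ 2) ≤ 1} with hKdef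
  set Ω : Set (EuclideanSpace ℝ (Fin n) × ℝ) :=
    {p | 0 < p.2 ∧ s * (‖p.1 - x₀‖ ^ 2 + p.2 ^ 2) < 1} with hΩdef
  have hΩK : Ω ⊆ K := fun q hq => ⟨hq.1.le, hq.2.le⟩
  have hΩu : Ω ⊆ upper n := fun q hq => hq.1
  have hcont : Continuous fun p : EuclideanSpace ℝ (Fin n) × ℝ =>
      s * (‖p.1 - x₀‖ ^ 2 + p.2 ^ 2) := by fun_prop
  have hΩ : IsOpen Ω := (isOpen_lt continuous_const continuous_snd).inter
    (isOpen_lt hcont continuous_const)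
  have hKcl : IsClosed K := (isClosed_le continuous_const continuous_snd).inter
    (isClosed_le hcont continuous_const)
  have hK : IsCompact K := by
    refine Metric.isCompact_of_isClosed_isBounded hKcl
      (Metric.isBounded_closedBall (x := (x₀, (0 : ℝ))) (r := Real.sqrt s⁻¹) |>.subset ?_)
    rintro q ⟨-, hq⟩
    have hq' : ‖q.1 - x₀‖ ^ 2 + q.2 ^ 2 ≤ s⁻¹ := by
      rw [← one_div, le_div_iff₀ hs]
      linarith
    rw [Metric.mem_closedBall, Prod.dist_eq, max_le_iff, dist_eq_norm, dist_eq_norm]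
    constructor
    · exact Real.le_sqrt_of_sq_le (by nlinarith [sq_nonneg q.2])
    · refine Real.le_sqrt_of_sq_le ?_
      rw [sub_zero, Real.norm_eq_abs, sq_abs]
      nlinarith [sq_nonneg ‖q.1 - x₀‖]
  have hηx : ∀ i, HasTwoLineDerivs Ω (dirX i)
      (fun p => 1 + -s * (‖p.1 - x₀‖ ^ 2 + p.2 ^ 2)) (fun p => -2 * s * (p.1 i - x₀ i))
      (fun _ => -2 * s) := by
    intro i
    convert (HasTwoLineDerivs.const (s := Ω) (v := dirX i) (1 : ℝ)).add
      (((hasTwoLineDerivs_normSq_dirX Ω x₀ i).add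
        (hasTwoLineDerivs_sndSq_dirX Ω i)).const_mul (-s)) using 2 <;> ring
  have hηy : HasTwoLineDerivs Ω (dirY n)
      (fun p => 1 + -s * (‖p.1 - x₀‖ ^ 2 + p.2 ^ 2)) (fun p => -2 * s * p.2)
      (fun _ => -2 * s) := by
    convert (HasTwoLineDerivs.const (s := Ω) (v := dirY n) (1 : ℝ)).add
      (((hasTwoLineDerivs_normSq_dirY Ω x₀).add
        (hasTwoLineDerivs_sndSq_dirY Ω)).const_mul (-s)) using 2 <;> ring
  -- The cutoff is centred on the boundary, so `∂_y η` is a multiple of `y` and `(α/y) ∂_y η` stays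
  -- bounded.
  set η : EuclideanSpace ℝ (Fin n) × ℝ → ℝ := fun p => 1 + -s * (‖p.1 - x₀‖ ^ 2 + p.2 ^ 2)
    with hη
  set κ : ℝ := gradConst n α * s with hκ
  have hκ0 : 0 ≤ κ := (mul_pos (gradConst_pos n α) hs).le
  have hqx : ∀ i, _ := fun i => ((hηx i).mul ((hg.hx i).mono hΩu))
  have hqy := (hηy.mul (hg.hy.mono hΩu))
  have hwx : ∀ i, _ := fun i => ((hqx i).mul (hqx i)).add
    ((((hf.hx i).mono hΩu).mul ((hf.hx i).mono hΩu)).const_mul κ)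
  have hwy := (hqy.mul hqy).add (((hf.hy.mono hΩu).mul (hf.hy.mono hΩu)).const_mul κ)
  have hKsub : K ⊆ {p | 0 ≤ p.2} := fun q hq => hq.1
  have hηc : Continuous η := by fun_prop
  -- The auxiliary function is `(ηg)² + κf²`. As `Lf = 0`, `L(κf²) = 2κ|∇f|² ≥ 2κg²`, which pays for
  -- all errors caused by `η`.
  have hmain := weak_maximum_principle hn α hK hΩ hΩK (M := κ * M ^ 2)
    (((hηc.continuousOn.mul (hgc.mono hKsub)).mul (hηc.continuousOn.mul (hgc.mono hKsub))).add
      (continuousOn_const.mul ((hfc.mono hKsub).mul (hfc.mono hKsub))))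
    hwx hwy ?_ ?_ p ⟨hp0, hp⟩
  · have h1 : 0 ≤ κ * (f p * f p) := mul_nonneg hκ0 (mul_self_nonneg _)
    have h2 : (1 - s * (‖p.1 - x₀‖ ^ 2 + p.2 ^ 2)) = η p := by simp only [hη]; ring
    rw [h2]
    change η p * g p * (η p * g p) + κ * (f p * f p) ≤ κ * M ^ 2 at hmain
    nlinarith
  · intro q hq
    have hy0 : q.2 ≠ 0 := hq.1.ne'
    have hη0 : 0 ≤ η q := by simp only [hη]; linarith [hq.2]
    have hη1 : η q ≤ 1 := by
      simp only [hη]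
      nlinarith [mul_nonneg hs.le (add_nonneg (sq_nonneg ‖q.1 - x₀‖) (sq_nonneg q.2))]
    have hfe := hf.eq_zero q (hΩu hq)
    have hge := hg.eq_zero q (hΩu hq)
    simp only [smul_eq_mul] at hfe hge
    have hxterm : ∀ i, -24 * s ^ 2 * (q.1 i - x₀ i) ^ 2 * g q ^ 2 - 4 * s * g q ^ 2
        + 2 * η q ^ 2 * (g q * gxx i q) + κ * (2 * fx i q ^ 2 + 2 * (f q * fxx i q)) ≤
        2 * (-2 * s * (q.1 i - x₀ i) * g q + η q * gx i q) ^ 2 + 2 * (η q * g q) *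
          (-2 * s * g q + 2 * (-2 * s * (q.1 i - x₀ i) * gx i q) + η q * gxx i q)
        + κ * (2 * fx i q ^ 2 + 2 * (f q * fxx i q)) := by
      intro i
      have := bernstein_direction (η q) (-2 * s * (q.1 i - x₀ i)) (-2 * s) (g q) (gx i q)
        (gxx i q)
      nlinarith [mul_nonneg (mul_nonneg hs.le (sub_nonneg.2 hη1)) (sq_nonneg (g q))]
    have hyterm := bernstein_direction (η q) (-2 * s * q.2) (-2 * s) (g q) (gy q) (gyy q)
    have hsumx := Finset.sum_le_sum (s := Finset.univ) fun i _ => hxterm i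
    have hn2 : ∑ i, (q.1 i - x₀ i) ^ 2 = ‖q.1 - x₀‖ ^ 2 := by
      rw [EuclideanSpace.norm_sq_eq]
      simp
    have hfx2 : fx i₀ q ^ 2 ≤ ∑ i, fx i q ^ 2 :=
      Finset.single_le_sum (f := fun i => fx i q ^ 2) (fun i _ => sq_nonneg _)
        (Finset.mem_univ i₀)
    rw [hfg q (hΩu hq)] at hfx2
    have hlow : ∑ i, (-24 * s ^ 2 * (q.1 i - x₀ i) ^ 2 * g q ^ 2 - 4 * s * g q ^ 2
        + 2 * η q ^ 2 * (g q * gxx i q) + κ * (2 * fx i q ^ 2 + 2 * (f q * fxx i q))) =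
        -24 * s ^ 2 * ‖q.1 - x₀‖ ^ 2 * g q ^ 2 - n * (4 * s * g q ^ 2)
        + 2 * η q ^ 2 * (g q * ∑ i, gxx i q)
        + κ * (2 * ∑ i, fx i q ^ 2 + 2 * (f q * ∑ i, fxx i q)) := by
      rw [← hn2]
      simp only [Finset.mul_sum, Finset.sum_mul, Finset.sum_add_distrib, Finset.sum_sub_distrib,
        mul_add]
      simp
    rw [hlow] at hsumx
    -- This is the subsolution inequality with the product-rule terms collected; `A` is the `x`-part
    -- and `B` the `y`-part of the cutoff term.
    have hgoal : ∀ A B : ℝ, A = ∑ i, (2 * (-2 * s * (q.1 i - x₀ i) * g q + η q * gx i q) ^ 2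
          + 2 * (η q * g q) *
          (-2 * s * g q + 2 * (-2 * s * (q.1 i - x₀ i) * gx i q) + η q * gxx i q)
        + κ * (2 * fx i q ^ 2 + 2 * (f q * fxx i q))) →
        B = (2 * (-2 * s * q.2 * g q + η q * gy q) ^ 2 + 2 * (η q * g q) *
          (-2 * s * g q + 2 * (-2 * s * q.2 * gy q) + η q * gyy q)) →
        0 ≤ A + (B + κ * (2 * fy q ^ 2 + 2 * (f q * fyy q)))
          - α / q.2 * (2 * (η q * g q) * (-2 * s * q.2 * g q + η q * gy q)
            + κ * (2 * (f q * fy q))) := by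
      rintro A B rfl rfl
      have hα : α / q.2 * (2 * (η q * g q) * (-2 * s * q.2 * g q + η q * gy q)
            + κ * (2 * (f q * fy q))) = -4 * s * α * η q * g q ^ 2
            + 2 * η q ^ 2 * (g q * (α / q.2 * gy q)) + 2 * κ * (f q * (α / q.2 * fy q)) := by
        field_simp
        ring
      rw [hα]
      have hg1 : ∑ i, gxx i q = α / q.2 * gy q - gyy q := by linarith
      have hf1 : ∑ i, fxx i q = α / q.2 * fy q - fyy q := by linarith
      rw [hg1, hf1] at hsumx
      have hball : s ^ 2 * (‖q.1 - x₀‖ ^ 2 + q.2 ^ 2) * g q ^ 2 ≤ s * g q ^ 2 := by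
        have := mul_le_mul_of_nonneg_left hq.2.le (mul_nonneg hs.le (sq_nonneg (g q)))
        nlinarith
      have hαb : -(|α| * (s * g q ^ 2)) ≤ α * η q * (s * g q ^ 2) := by
        have h1 : |α * η q| ≤ |α| := by
          rw [abs_mul, abs_of_nonneg hη0]
          exact mul_le_of_le_one_right (abs_nonneg _) hη1
        have h2 := (abs_le.1 h1).1
        have := mul_le_mul_of_nonneg_right h2 (mul_nonneg hs.le (sq_nonneg (g q)))
        linarith
      have hηb : η q * (s * g q ^ 2) ≤ s * g q ^ 2 :=
        mul_le_of_le_one_left (mul_nonneg hs.le (sq_nonneg _)) hη1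
      have hκb : κ * g q ^ 2 ≤ κ * ∑ i, fx i q ^ 2 := mul_le_mul_of_nonneg_left hfx2 hκ0
      -- The errors total at most `(24 + 4(n+1) + 4|α|) s g²`: from `|∇η|²`, from the `n + 1` pure
      -- second derivatives of `η`, and from the first-order term. The gain is `2κg²`, so
      -- `gradConst` is half this sum.
      have hκe : κ * g q ^ 2 = 12 * (s * g q ^ 2) + 2 * (n + 1) * (s * g q ^ 2)
          + 2 * (|α| * (s * g q ^ 2)) := by
        rw [hκ, gradConst]
        ring
      have hfy2 : 0 ≤ κ * fy q ^ 2 := mul_nonneg hκ0 (sq_nonneg _)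
      linear_combination hsumx + hyterm + 24 * hball + 4 * hαb + 4 * hηb + 2 * hκb - 2 * hκe
        + 2 * hfy2
    refine (hgoal _ _ rfl rfl).trans (le_of_eq ?_)
    congr 1
    · congr 1
      · exact Finset.sum_congr rfl fun i _ => by ring
      · ring
    · ring
  · rintro q ⟨hqK, hqΩ⟩
    change η q * g q * (η q * g q) + κ * (f q * f q) ≤ κ * M ^ 2
    rcases hqK.1.eq_or_lt with h0 | h0
    · have hq' : q = (q.1, 0) := Prod.ext rfl h0.symm
      have h1 : f q = 0 := by rw [hq']; exact hf0 _
      have h2 : g q = 0 := by rw [hq']; exact hg0 _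
      rw [h1, h2]
      simpa using mul_nonneg hκ0 (sq_nonneg M)
    · have h1 : s * (‖q.1 - x₀‖ ^ 2 + q.2 ^ 2) = 1 :=
        le_antisymm hqK.2 (not_lt.1 fun h => hqΩ ⟨h0, h⟩)
      have h2 : η q = 0 := by simp only [hη]; linarith
      have h3 : f q ^ 2 ≤ M ^ 2 := by
        rw [← sq_abs]
        exact pow_le_pow_left₀ (abs_nonneg _) (hM q h0 h1.le) 2
      rw [h2]
      nlinarith [mul_le_mul_of_nonneg_left h3 hκ0]


/-! ### Tangential mollification. -/

/-- A smooth compactly supported function. -/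
structure IsTest {n : ℕ} (φ : EuclideanSpace ℝ (Fin n) → ℝ) : Prop where
  smooth : ContDiff ℝ (⊤ : ℕ∞) φ
  supp : HasCompactSupport φ

/-- Convolution in the tangential variables, `(x, y) ↦ ∫ φ(t) u(x - t, y) dt`. -/
noncomputable def mollify {n : ℕ} (φ : EuclideanSpace ℝ (Fin n) → ℝ)
    (u : EuclideanSpace ℝ (Fin n) × ℝ → ℂ) (p : EuclideanSpace ℝ (Fin n) × ℝ) : ℂ :=
  ∫ t, φ t • u (p - (t, 0))

/-- The derivative of `φ` in the direction `e`. -/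
noncomputable def testDeriv {n : ℕ} (e : EuclideanSpace ℝ (Fin n))
    (φ : EuclideanSpace ℝ (Fin n) → ℝ) (t : EuclideanSpace ℝ (Fin n)) : ℝ :=
  fderiv ℝ φ t e

section Mollify

variable {n : ℕ} {φ : EuclideanSpace ℝ (Fin n) → ℝ} {u w : EuclideanSpace ℝ (Fin n) × ℝ → ℂ}

theorem IsTest.continuous (hφ : IsTest φ) : Continuous φ := hφ.smooth.continuous

theorem IsTest.testDeriv (hφ : IsTest φ) (e : EuclideanSpace ℝ (Fin n)) :
    IsTest (testDeriv e φ) := by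
  refine ⟨?_, ?_⟩
  · exact (hφ.smooth.fderiv_right (m := (⊤ : ℕ∞)) (by simp)).clm_apply contDiff_const
  · exact (hφ.supp.fderiv ℝ).comp_left (g := fun L : _ →L[ℝ] ℝ => L e) (by simp)

theorem sub_mem_upper {p : EuclideanSpace ℝ (Fin n) × ℝ} (hp : p ∈ upper n)
    (t : EuclideanSpace ℝ (Fin n)) : p - (t, (0 : ℝ)) ∈ upper n := by
  simpa [upper] using hp

theorem continuousOn_mollify_integrand (hφ : IsTest φ) (hu : ContinuousOn u (upper n)) :
    ContinuousOn (Function.uncurry fun (p : EuclideanSpace ℝ (Fin n) × ℝ) t =>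
      φ t • u (p - (t, (0 : ℝ)))) (upper n ×ˢ Set.univ) := by
  have h1 : ContinuousOn (fun q : (EuclideanSpace ℝ (Fin n) × ℝ) × EuclideanSpace ℝ (Fin n) =>
      u (q.1 - (q.2, (0 : ℝ)))) (upper n ×ˢ Set.univ) :=
    hu.comp (by fun_prop) fun q hq => sub_mem_upper hq.1 q.2
  exact (hφ.continuous.comp continuous_snd).continuousOn.smul h1

theorem continuousOn_mollify (hφ : IsTest φ) (hu : ContinuousOn u (upper n)) :
    ContinuousOn (mollify φ u) (upper n) := by
  refine continuousOn_integral_of_compact_support (k := tsupport φ) hφ.supp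
    (continuousOn_mollify_integrand hφ hu) fun p t _ ht => ?_
  rw [image_eq_zero_of_notMem_tsupport ht, zero_smul]

theorem continuous_mollify_integrand (hφ : IsTest φ) (hu : ContinuousOn u (upper n))
    {p : EuclideanSpace ℝ (Fin n) × ℝ} (hp : p ∈ upper n) :
    Continuous fun t => φ t • u (p - (t, (0 : ℝ))) :=
  (continuousOn_mollify_integrand hφ hu).comp_continuous (f := fun t => (p, t)) (by fun_prop)
    fun t => ⟨hp, Set.mem_univ _⟩

theorem integrable_mollify_integrand (hφ : IsTest φ) (hu : ContinuousOn u (upper n))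
    {p : EuclideanSpace ℝ (Fin n) × ℝ} (hp : p ∈ upper n) :
    Integrable fun t => φ t • u (p - (t, (0 : ℝ))) :=
  (continuous_mollify_integrand hφ hu hp).integrable_of_hasCompactSupport hφ.supp.smul_right

theorem hasLineDerivAt_mollify (hφ : IsTest φ) (hu : ContinuousOn u (upper n))
    (hw : ContinuousOn w (upper n)) {v : EuclideanSpace ℝ (Fin n) × ℝ}
    (hd : ∀ p ∈ upper n, HasLineDerivAt ℝ u (w p) p v) {p : EuclideanSpace ℝ (Fin n) × ℝ}
    (hp : p ∈ upper n) : HasLineDerivAt ℝ (mollify φ u) (mollify φ w p) p v := by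
  have hl : Tendsto (fun s : ℝ => p + s • v) (𝓝 0) (𝓝 p) := by
    have : ContinuousAt (fun s : ℝ => p + s • v) 0 := by fun_prop
    simpa [ContinuousAt] using this
  obtain ⟨δ, hδ, hδu⟩ := Metric.nhds_basis_closedBall.mem_iff.1
    (hl ((isOpen_upper n).mem_nhds hp))
  have hcompact : IsCompact (Metric.closedBall (0 : ℝ) δ ×ˢ tsupport φ) :=
    (isCompact_closedBall _ _).prod hφ.supp
  -- Compactness in the line parameter and in the support of `φ` gives a dominating function,
  -- constant on the support.
  obtain ⟨C, hC⟩ := hcompact.exists_bound_of_continuousOn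
    (f := fun q : ℝ × EuclideanSpace ℝ (Fin n) => φ q.2 • w (p + q.1 • v - (q.2, (0 : ℝ))))
    ((continuousOn_mollify_integrand hφ hw).comp
      (f := fun q : ℝ × EuclideanSpace ℝ (Fin n) => (p + q.1 • v, q.2))
      (by fun_prop) fun q hq => ⟨hδu hq.1, Set.mem_univ _⟩)
  have hp0 : p + (0 : ℝ) • v ∈ upper n := by simpa using hp
  have key := hasDerivAt_integral_of_dominated_loc_of_deriv_le (μ := volume) (𝕜 := ℝ)
    (F := fun s t => φ t • u (p + s • v - (t, (0 : ℝ))))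
    (F' := fun s t => φ t • w (p + s • v - (t, (0 : ℝ))))
    (x₀ := 0) (s := Metric.closedBall (0 : ℝ) δ) (bound := (tsupport φ).indicator fun _ => C)
    (Metric.closedBall_mem_nhds _ hδ) ?_ (integrable_mollify_integrand hφ hu hp0)
    (continuous_mollify_integrand hφ hw hp0).aestronglyMeasurable ?_ ?_ ?_
  · have h2 := key.2
    simp only [zero_smul, add_zero] at h2
    exact h2
  · filter_upwards [Metric.closedBall_mem_nhds (0 : ℝ) hδ] with s hs
    exact (continuous_mollify_integrand hφ hu (hδu hs)).aestronglyMeasurable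
  · refine Eventually.of_forall fun t s hs => ?_
    by_cases ht : t ∈ tsupport φ
    · rw [Set.indicator_of_mem ht]
      exact hC (s, t) ⟨hs, ht⟩
    · rw [Set.indicator_of_notMem ht, image_eq_zero_of_notMem_tsupport ht]
      simp
  · exact (integrable_indicator_iff (isClosed_tsupport φ).measurableSet).2
      (integrableOn_const hφ.supp.measure_ne_top)
  · refine Eventually.of_forall fun t s hs => HasDerivAt.const_smul (φ t) ?_
    have h1 : HasDerivAt (fun r : ℝ => u (p + s • v - (t, (0 : ℝ)) + r • v))
        (w (p + s • v - (t, (0 : ℝ)))) (s - s) := by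
      rw [sub_self]
      exact hd _ (sub_mem_upper (hδu hs) t)
    have h2 := HasDerivAt.comp_sub_const s s h1
    refine h2.congr_of_eventuallyEq (Eventually.of_forall fun r => ?_)
    simp only [sub_smul]
    congr 1
    abel

theorem SolvesWith.mollify {α : ℝ} {ux uxx : Fin n → EuclideanSpace ℝ (Fin n) × ℝ → ℂ}
    {uy uyy : EuclideanSpace ℝ (Fin n) × ℝ → ℂ} (h : SolvesWith α u ux uxx uy uyy)
    (hφ : IsTest φ) (hu : ContinuousOn u (upper n)) (hux : ∀ i, ContinuousOn (ux i) (upper n))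
    (huxx : ∀ i, ContinuousOn (uxx i) (upper n)) (huy : ContinuousOn uy (upper n))
    (huyy : ContinuousOn uyy (upper n)) :
    SolvesWith α (HalfSpace.mollify φ u) (fun i => HalfSpace.mollify φ (ux i))
      (fun i => HalfSpace.mollify φ (uxx i)) (HalfSpace.mollify φ uy)
      (HalfSpace.mollify φ uyy) := by
  refine ⟨fun i => ⟨fun p hp => hasLineDerivAt_mollify hφ hu (hux i) (h.hx i).fst hp,
    fun p hp => hasLineDerivAt_mollify hφ (hux i) (huxx i) (h.hx i).snd hp⟩,
    ⟨fun p hp => hasLineDerivAt_mollify hφ hu huy h.hy.fst hp,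
    fun p hp => hasLineDerivAt_mollify hφ huy huyy h.hy.snd hp⟩, fun p hp => ?_⟩
  have h1 := fun i => integrable_mollify_integrand hφ (huxx i) hp
  have h2 := integrable_mollify_integrand hφ huyy hp
  have h3 := integrable_mollify_integrand hφ huy hp
  simp only [HalfSpace.mollify]
  have h4 : Integrable fun t => (α / p.2) • φ t • uy (p - (t, (0 : ℝ))) :=
    h3.smul (α / p.2)
  have h5 : Integrable fun t => ∑ i, φ t • uxx i (p - (t, (0 : ℝ))) :=
    integrable_finsetSum _ fun i _ => h1 i
  have h6 : Integrable fun t => ∑ i, φ t • uxx i (p - (t, (0 : ℝ)))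
      + φ t • uyy (p - (t, (0 : ℝ))) := h5.add h2
  rw [← integral_finsetSum _ fun i _ => h1 i, ← integral_add h5 h2, ← integral_smul,
    ← integral_sub h6 h4]
  rw [integral_eq_zero_of_ae]
  refine Eventually.of_forall fun t => ?_
  have := congrArg (fun z => φ t • z) (h.eq_zero _ (sub_mem_upper hp t))
  simp only [smul_sub, smul_add, Finset.smul_sum, smul_zero] at this
  rw [smul_comm] at this
  simpa using this

theorem mollify_eq_integral_sub (φ : EuclideanSpace ℝ (Fin n) → ℝ)
    (u : EuclideanSpace ℝ (Fin n) × ℝ → ℂ) (x : EuclideanSpace ℝ (Fin n)) (y : ℝ) :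
    mollify φ u (x, y) = ∫ t, φ (x - t) • u (t, y) := by
  rw [← integral_sub_left_eq_self _ volume x]
  simp [mollify]

theorem continuous_slice (hu : ContinuousOn u (upper n)) {y : ℝ} (hy : 0 < y) :
    Continuous fun x => u (x, y) :=
  hu.comp_continuous (by fun_prop) fun _ => hy

/-- The derivative falls on `φ`, so continuity of `u` suffices and tangential derivatives of every
order are available. -/
theorem hasLineDerivAt_mollify_testDeriv (hφ : IsTest φ) (hu : ContinuousOn u (upper n))
    (e : EuclideanSpace ℝ (Fin n)) {p : EuclideanSpace ℝ (Fin n) × ℝ} (hp : p ∈ upper n) :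
    HasLineDerivAt ℝ (mollify φ u) (mollify (testDeriv e φ) u p) p (e, 0) := by
  have hc := continuous_slice hu (show 0 < p.2 from hp)
  have h := hφ.supp.hasFDerivAt_convolution_left (ContinuousLinearMap.lsmul ℝ ℝ)
    (μ := volume) (hφ.smooth.of_le (by exact_mod_cast le_top)) hc.locallyIntegrable p.1
  have h1 : HasDerivAt (fun s : ℝ => p.1 + s • e) e 0 := by
    simpa using ((hasDerivAt_id (0 : ℝ)).smul_const e).const_add p.1
  have h2 := HasFDerivAt.comp_hasDerivAt_of_eq (0 : ℝ) h h1 (by simp)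
  refine HasDerivAt.congr_deriv (h2.congr_of_eventuallyEq (Eventually.of_forall fun s => ?_)) ?_
  · simp [mollify, convolution, Prod.sub_def]
  · rw [convolution, ContinuousLinearMap.integral_apply]
    · simp [mollify, testDeriv, Prod.sub_def]
    · exact ((hφ.supp.fderiv ℝ).convolutionExists_left _
        (hφ.smooth.continuous_fderiv (by simp)) hc.locallyIntegrable) p.1

theorem mollify_testDeriv_eq_sum (hφ : IsTest φ) (hu : ContinuousOn u (upper n))
    (e : EuclideanSpace ℝ (Fin n)) {p : EuclideanSpace ℝ (Fin n) × ℝ} (hp : p ∈ upper n) :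
    mollify (testDeriv e φ) u p =
      ∑ i, e i • mollify (testDeriv (EuclideanSpace.single i 1) φ) u p := by
  simp only [mollify]
  simp_rw [← integral_smul]
  have hi : ∀ i, Integrable fun t =>
      e i • testDeriv (EuclideanSpace.single i 1) φ t • u (p - (t, (0 : ℝ))) :=
    fun i => (integrable_mollify_integrand (hφ.testDeriv _) hu hp).smul (e i)
  rw [← integral_finsetSum _ fun i _ => hi i]
  congr 1 with t
  simp_rw [smul_smul, ← Finset.sum_smul]
  congr 1
  have he : e = ∑ i, e i • EuclideanSpace.single i (1 : ℝ) := by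
    ext j
    simp [Pi.single_apply]
  simp only [testDeriv]
  conv_lhs => rw [he]
  simp

end Mollify


/-! ### Continuity of the mollified solution up to the boundary. -/

section Boundary

variable {n : ℕ} {φ : EuclideanSpace ℝ (Fin n) → ℝ} {u : EuclideanSpace ℝ (Fin n) × ℝ → ℂ}

/-- The slices `u(·, y)` tend to zero as `y → 0+` when tested on smooth compactly supported
functions. -/
def TestsToZero (u : EuclideanSpace ℝ (Fin n) × ℝ → ℂ) : Prop :=
  ∀ ψ : EuclideanSpace ℝ (Fin n) → ℝ, IsTest ψ →
    Tendsto (fun y => ∫ x, ψ x • u (x, y)) (𝓝[>] 0) (𝓝 0)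

theorem HasBoundaryLimit.testsToZero (h : HasBoundaryLimit u 0) : TestsToZero u := by
  intro ψ hψ
  obtain ⟨T, hT, hlim⟩ := h
  have hs : HasCompactSupport fun x => (ψ x : ℂ) :=
    hψ.supp.comp_left (g := fun r : ℝ => (r : ℂ)) (by simp)
  have hc : ContDiff ℝ (⊤ : ℕ∞) fun x => (ψ x : ℂ) := Complex.ofRealCLM.contDiff.comp hψ.smooth
  obtain ⟨S, hS⟩ : ∃ S : 𝓢(EuclideanSpace ℝ (Fin n), ℂ), ∀ x, S x = ψ x :=
    ⟨hs.toSchwartzMap hc, fun _ => rfl⟩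
  have hSs : HasCompactSupport S := by
    rw [show (S : EuclideanSpace ℝ (Fin n) → ℂ) = fun x => (ψ x : ℂ) from funext hS]
    exact hs
  have h1 := PointwiseConvergenceCLM.tendsto_iff_forall_tendsto.1 hlim S
  rw [show (0 : 𝓢'(EuclideanSpace ℝ (Fin n), ℂ)) S = 0 by simp] at h1
  refine Tendsto.congr' ?_ h1
  filter_upwards [hT] with y hy
  rw [hy.2 S hSs]
  simp only [hS, Complex.real_smul]

theorem IsTest.comp_sub_left (hφ : IsTest φ) (x : EuclideanSpace ℝ (Fin n)) :
    IsTest fun t => φ (x - t) :=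
  ⟨hφ.smooth.comp (contDiff_const.sub contDiff_id),
    hφ.supp.comp_homeomorph (Homeomorph.subLeft x)⟩

theorem tendsto_mollify_boundary (hu : TestsToZero u) (hφ : IsTest φ)
    (x : EuclideanSpace ℝ (Fin n)) :
    Tendsto (fun y => mollify φ u (x, y)) (𝓝[>] 0) (𝓝 0) := by
  simp_rw [mollify_eq_integral_sub]
  exact hu _ (hφ.comp_sub_left x)

theorem summable_norm_of_lp_one (c : lp (fun _ : ℕ => ℝ) 1) : Summable fun k => ‖c k‖ := by
  simpa using (lp.memℓp c).summable (by simp)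

theorem norm_eq_tsum_of_lp_one (c : lp (fun _ : ℕ => ℝ) 1) : ‖c‖ = ∑' k, ‖c k‖ := by
  simpa using lp.norm_eq_tsum_rpow (p := 1) (by simp) c

theorem exists_bound_iteratedFDeriv (hφ : IsTest φ) (k : ℕ) :
    ∃ C, ∀ t, ‖iteratedFDeriv ℝ k φ t‖ ≤ C :=
  ((hφ.supp.iteratedFDeriv k).exists_bound_of_continuous
    (hφ.smooth.continuous_iteratedFDeriv (by exact_mod_cast le_top)))

/-- Derivative bounds of `φ` are translation invariant, so `ℓ¹` coefficients make every
differentiated series converge uniformly. Bounded centres keep the supports in one ball. -/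
theorem isTest_tsum_translates (hφ : IsTest φ) {ρ : ℝ} {x : ℕ → EuclideanSpace ℝ (Fin n)}
    (hx : ∀ k, x k ∈ Metric.closedBall 0 ρ) (c : lp (fun _ : ℕ => ℝ) 1) :
    IsTest fun t => ∑' k, c k * φ (x k - t) := by
  choose C hC using exists_bound_iteratedFDeriv (hφ.comp_sub_left 0)
  have hsum := summable_norm_of_lp_one c
  refine ⟨?_, ?_⟩
  · refine contDiff_tsum (v := fun m k => ‖c k‖ * C m)
      (fun k => contDiff_const.mul (hφ.comp_sub_left (x k)).smooth)
      (fun m _ => hsum.mul_right _) fun m k t _ => ?_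
    have h1 : (fun t => c k * φ (x k - t)) = c k • fun t => φ (0 - (t - x k)) := by
      ext t
      simp
    have h2 : iteratedFDeriv ℝ m (fun t => φ (0 - (t - x k))) t
        = iteratedFDeriv ℝ m (fun t => φ (0 - t)) (t - x k) :=
      iteratedFDeriv_comp_sub (f := fun t => φ (0 - t)) m (x k) t
    have h3 : ContDiff ℝ m fun t => φ (0 - (t - x k)) :=
      ((hφ.comp_sub_left 0).smooth.comp (contDiff_id.sub contDiff_const)).of_le
        (by exact_mod_cast le_top)
    rw [h1, iteratedFDeriv_const_smul_apply h3.contDiffAt, norm_smul, h2]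
    gcongr
    exact hC _ _
  · obtain ⟨a, ha⟩ := hφ.supp.isBounded.subset_closedBall 0
    refine HasCompactSupport.intro (isCompact_closedBall (0 : EuclideanSpace ℝ (Fin n)) (ρ + a))
      fun t ht => ?_
    refine (tsum_congr fun k => ?_).trans tsum_zero
    rw [image_eq_zero_of_notMem_tsupport (f := φ) fun h => ht ?_, mul_zero]
    have h1 := ha h
    have h2 := hx k
    rw [mem_closedBall_zero_iff] at h1 h2 ⊢
    calc ‖t‖ = ‖x k - (x k - t)‖ := by rw [sub_sub_cancel]
      _ ≤ ‖x k‖ + ‖x k - t‖ := norm_sub_le _ _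
      _ ≤ ρ + a := add_le_add h2 h1

theorem integral_tsum_translates (hφ : IsTest φ) (hu : ContinuousOn u (upper n)) {ρ : ℝ}
    {x : ℕ → EuclideanSpace ℝ (Fin n)}
    (hx : ∀ k, x k ∈ Metric.closedBall 0 ρ) (c : lp (fun _ : ℕ => ℝ) 1) {y : ℝ} (hy : 0 < y) :
    ∫ t, (∑' k, c k * φ (x k - t)) • u (t, y) = ∑' k, c k • mollify φ u (x k, y) := by
  have hsum := summable_norm_of_lp_one c
  obtain ⟨a, ha⟩ := hφ.supp.isBounded.subset_closedBall 0
  obtain ⟨C, hC⟩ := hφ.supp.exists_bound_of_continuous hφ.continuous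
  have hC0 : 0 ≤ C := (norm_nonneg _).trans (hC 0)
  have hslice := continuous_slice hu hy
  set B := Metric.closedBall (0 : EuclideanSpace ℝ (Fin n)) (ρ + a) with hB
  have hD : Integrable (B.indicator fun t => C * ‖u (t, y)‖) :=
    (integrable_indicator_iff Metric.isClosed_closedBall.measurableSet).2
      ((continuous_const.mul hslice.norm).continuousOn.integrableOn_compact
        (isCompact_closedBall _ _))
  have hbound : ∀ k t, ‖(c k * φ (x k - t)) • u (t, y)‖ ≤
      ‖c k‖ * B.indicator (fun t => C * ‖u (t, y)‖) t := by
    intro k t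
    rw [norm_smul, norm_mul, mul_assoc]
    gcongr
    by_cases ht : t ∈ B
    · rw [Set.indicator_of_mem ht]
      gcongr
      exact hC _
    · rw [Set.indicator_of_notMem ht, image_eq_zero_of_notMem_tsupport (f := φ) fun h => ht ?_]
      · simp
      have h1 := ha h
      have h2 := hx k
      rw [mem_closedBall_zero_iff] at h1 h2
      rw [hB, mem_closedBall_zero_iff]
      calc ‖t‖ = ‖x k - (x k - t)‖ := by rw [sub_sub_cancel]
        _ ≤ ‖x k‖ + ‖x k - t‖ := norm_sub_le _ _
        _ ≤ ρ + a := add_le_add h2 h1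
  have hint : ∀ k, Integrable fun t => (c k * φ (x k - t)) • u (t, y) := fun k =>
    (hD.const_mul ‖c k‖).mono' (by
      have := (hφ.comp_sub_left (x k)).continuous
      exact ((continuous_const.mul this).smul hslice).aestronglyMeasurable)
      (Eventually.of_forall (hbound k))
  have hsum2 : Summable fun k => ∫ t, ‖(c k * φ (x k - t)) • u (t, y)‖ := by
    refine Summable.of_nonneg_of_le (fun k => integral_nonneg fun t => norm_nonneg _)
      (fun k => ?_) (hsum.mul_right (∫ t, B.indicator (fun t => C * ‖u (t, y)‖) t))
    rw [← integral_const_mul]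
    exact integral_mono (hint k).norm (hD.const_mul _) (hbound k)
  have key := (hasSum_integral_of_summable_integral_norm hint hsum2).tsum_eq
  have hs : ∀ t, Summable fun k => c k * φ (x k - t) := fun t =>
    Summable.of_norm_bounded (hsum.mul_right C) fun k => by
      rw [norm_mul]
      gcongr
      exact hC _
  calc ∫ t, (∑' k, c k * φ (x k - t)) • u (t, y)
      = ∫ t, ∑' k, (c k * φ (x k - t)) • u (t, y) := by
        congr 1 with t
        rw [(hs t).tsum_smul_const]
    _ = ∑' k, ∫ t, (c k * φ (x k - t)) • u (t, y) := key.symm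
    _ = ∑' k, c k • mollify φ u (x k, y) := by
        refine tsum_congr fun k => ?_
        rw [mollify_eq_integral_sub, ← integral_smul]
        simp only [mul_smul]

theorem exists_bound_slice (hφ : IsTest φ) (hu : ContinuousOn u (upper n)) (ρ : ℝ) {y : ℝ}
    (hy : 0 < y) : ∃ B, ∀ x ∈ Metric.closedBall (0 : EuclideanSpace ℝ (Fin n)) ρ,
      ‖mollify φ u (x, y)‖ ≤ B :=
  (isCompact_closedBall _ _).exists_bound_of_continuousOn
    (continuous_slice (continuousOn_mollify hφ hu) hy).continuousOn

/-- Uniform boundedness along sequences approaching the boundary. -/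
theorem exists_bound_sequence (hφ : IsTest φ) (hu : ContinuousOn u (upper n))
    (hb : TestsToZero u) {ρ : ℝ} {x : ℕ → EuclideanSpace ℝ (Fin n)} {y : ℕ → ℝ}
    (hx : ∀ k, x k ∈ Metric.closedBall 0 ρ) (hy : ∀ k, 0 < y k) (hy0 : Tendsto y atTop (𝓝 0)) :
    ∃ C, ∀ k, ‖mollify φ u (x k, y k)‖ ≤ C := by
  choose B hB using fun j => exists_bound_slice hφ hu ρ (hy j)
  have hsm : ∀ (c : lp (fun _ : ℕ => ℝ) 1) j,
      Summable fun k => ‖c k • mollify φ u (x k, y j)‖ := fun c j =>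
    Summable.of_nonneg_of_le (fun k => norm_nonneg _) (fun k => by
      rw [norm_smul]
      gcongr
      exact hB j _ (hx k)) ((summable_norm_of_lp_one c).mul_right (B j))
  -- `S j c` pairs the slice at height `y j` with the test function `∑ c_k φ(x_k - ·)`. For fixed
  -- `c` it tends to zero, so Banach–Steinhaus on `ℓ¹` applies; the unit vector at `k` then recovers
  -- the value at `(x k, y k)`.
  let S : ℕ → lp (fun _ : ℕ => ℝ) 1 →L[ℝ] ℂ := fun j =>
    LinearMap.mkContinuous
      { toFun := fun c => ∑' k, c k • mollify φ u (x k, y j)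
        map_add' := fun c d => by
          simp only [lp.coeFn_add, Pi.add_apply, add_smul]
          exact (hsm c j).of_norm.tsum_add (hsm d j).of_norm
        map_smul' := fun r c => by
          simp only [lp.coeFn_smul, Pi.smul_apply, smul_eq_mul, mul_smul, RingHom.id_apply]
          exact tsum_const_smul'' r } (B j) fun c => by
      rw [norm_eq_tsum_of_lp_one, ← tsum_mul_left]
      refine (norm_tsum_le_tsum_norm (hsm c j)).trans ((hsm c j).tsum_le_tsum (fun k => ?_)
        ((summable_norm_of_lp_one c).mul_left (B j)))
      rw [norm_smul, mul_comm]
      gcongr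
      exact hB j _ (hx k)
  have hyw : Tendsto y atTop (𝓝[>] 0) :=
    tendsto_nhdsWithin_iff.2 ⟨hy0, Eventually.of_forall hy⟩
  obtain ⟨C, hC⟩ := banach_steinhaus (g := S) fun c => by
    have h1 := (hb _ (isTest_tsum_translates hφ hx c)).comp hyw
    obtain ⟨A, hA⟩ := h1.norm.bddAbove_range
    refine ⟨A, fun j => ?_⟩
    have h2 := hA ⟨j, rfl⟩
    simp only [Function.comp_apply] at h2
    rwa [integral_tsum_translates hφ hu hx c (hy j)] at h2
  refine ⟨C, fun k => ?_⟩
  have h1 := (S k).le_of_opNorm_le (hC k) (lp.single 1 k (1 : ℝ))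
  have h2 : S k (lp.single 1 k (1 : ℝ)) = mollify φ u (x k, y k) := by
    change ∑' m, (lp.single 1 k (1 : ℝ) : lp (fun _ : ℕ => ℝ) 1) m • mollify φ u (x m, y k) = _
    rw [tsum_eq_single k fun m hm => ?_]
    · simp
    · rw [lp.single_apply_ne _ _ _ hm, zero_smul]
  rw [h2, lp.norm_single (by simp)] at h1
  simpa using h1

theorem exists_bound_near_boundary (hφ : IsTest φ) (hu : ContinuousOn u (upper n))
    (hb : TestsToZero u) (ρ : ℝ) :
    ∃ C, ∃ δ > 0, ∀ x ∈ Metric.closedBall (0 : EuclideanSpace ℝ (Fin n)) ρ, ∀ y, 0 < y → y < δ →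
      ‖mollify φ u (x, y)‖ ≤ C := by
  by_contra! h
  -- Failure with constant `m` and height `1/(m+1)` yields a sequence reaching the boundary on which
  -- the values are unbounded.
  choose x hx y hy hyδ hbig using fun m : ℕ => h m (1 / ((m : ℝ) + 1)) (by positivity)
  obtain ⟨C, hC⟩ := exists_bound_sequence hφ hu hb hx hy
    (squeeze_zero (fun m => (hy m).le) (fun m => (hyδ m).le) tendsto_one_div_add_atTop_nhds_zero_nat)
  obtain ⟨m, hm⟩ := exists_nat_gt C
  linarith [hC m, hbig m]

theorem norm_mollify_sub_le (hφ : IsTest φ) (hu : ContinuousOn u (upper n)) {y : ℝ} (hy : 0 < y)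
    {x₀ x : EuclideanSpace ℝ (Fin n)} {C : Fin n → ℝ}
    (hC : ∀ i, ∀ z ∈ segment ℝ x₀ x,
      ‖mollify (testDeriv (EuclideanSpace.single i 1) φ) u (z, y)‖ ≤ C i) :
    ‖mollify φ u (x, y) - mollify φ u (x₀, y)‖ ≤ (∑ i, C i) * ‖x - x₀‖ := by
  have hd : ∀ s ∈ Set.Icc (0 : ℝ) 1,
      HasDerivWithinAt (fun s : ℝ => mollify φ u (x₀ + s • (x - x₀), y))
        (mollify (testDeriv (x - x₀) φ) u (x₀ + s • (x - x₀), y)) (Set.Icc 0 1) s := by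
    intro s _
    have h1 : HasDerivAt (fun r : ℝ => mollify φ u
        ((x₀ + s • (x - x₀), y) + r • (x - x₀, (0 : ℝ))))
        (mollify (testDeriv (x - x₀) φ) u (x₀ + s • (x - x₀), y)) (s - s) := by
      rw [sub_self]
      exact hasLineDerivAt_mollify_testDeriv hφ hu (x - x₀) (show (_, y) ∈ upper n from hy)
    have h2 := HasDerivAt.comp_sub_const s s h1
    refine (h2.congr_of_eventuallyEq (Eventually.of_forall fun r => ?_)).hasDerivWithinAt
    simp only [Prod.smul_mk, smul_zero, Prod.mk_add_mk, add_zero]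
    congr 2
    rw [sub_smul]
    abel
  have h := norm_image_sub_le_of_norm_deriv_le_segment_01' hd
    (C := (∑ i, C i) * ‖x - x₀‖) fun s hs => ?_
  · simpa using h
  · rw [mollify_testDeriv_eq_sum hφ hu (x - x₀) (show (_, y) ∈ upper n from hy), Finset.sum_mul]
    refine norm_sum_le_of_le _ fun i _ => ?_
    have h3 := hC i (x₀ + s • (x - x₀)) ?_
    · rw [norm_smul, mul_comm]
      exact mul_le_mul h3 (PiLp.norm_apply_le (x - x₀) i) (norm_nonneg _)
        ((norm_nonneg _).trans h3)
    · rw [segment_eq_image']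
      exact ⟨s, ⟨hs.1, hs.2.le⟩, rfl⟩

theorem mollify_eq_zero_of_nonpos (h0 : ∀ p : EuclideanSpace ℝ (Fin n) × ℝ, p.2 ≤ 0 → u p = 0)
    {p : EuclideanSpace ℝ (Fin n) × ℝ} (hp : p.2 ≤ 0) : mollify φ u p = 0 := by
  simp only [mollify]
  rw [integral_eq_zero_of_ae]
  refine Eventually.of_forall fun t => ?_
  simp [h0 (p - (t, 0)) (by simpa using hp)]

/-- Near a boundary point the value is compared with the one on the vertical line through it. That
one tends to zero, and the difference is at most a constant times `‖x - x₀‖`, uniformly in small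
`y`. -/
theorem continuousOn_mollify_closed (hφ : IsTest φ) (hu : ContinuousOn u (upper n))
    (hb : TestsToZero u) (h0 : ∀ p : EuclideanSpace ℝ (Fin n) × ℝ, p.2 ≤ 0 → u p = 0) :
    ContinuousOn (mollify φ u) {p | 0 ≤ p.2} := by
  rintro ⟨x₀, y₀⟩ (hp : 0 ≤ y₀)
  rcases hp.eq_or_lt with rfl | hp
  swap
  · exact ((continuousOn_mollify hφ hu).continuousAt
      ((isOpen_upper n).mem_nhds hp)).continuousWithinAt
  rw [ContinuousWithinAt, mollify_eq_zero_of_nonpos h0 le_rfl]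
  choose C δ hδ hC using fun i => exists_bound_near_boundary
    (hφ.testDeriv (EuclideanSpace.single i (1 : ℝ))) hu hb (‖x₀‖ + 1)
  have hvert : Tendsto (fun y => mollify φ u (x₀, y)) (𝓝[≥] 0) (𝓝 0) := by
    rw [← Set.Ioi_insert, nhdsWithin_insert, tendsto_sup]
    refine ⟨?_, tendsto_mollify_boundary hb hφ x₀⟩
    rw [← mollify_eq_zero_of_nonpos (φ := φ) h0 (p := (x₀, 0)) le_rfl]
    exact tendsto_pure_nhds _ _
  have hsnd : Tendsto (fun p : EuclideanSpace ℝ (Fin n) × ℝ => p.2)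
      (𝓝[{p | 0 ≤ p.2}] (x₀, 0)) (𝓝[≥] 0) :=
    tendsto_nhdsWithin_iff.2 ⟨(continuous_snd.tendsto (x₀, (0 : ℝ))).mono_left
      nhdsWithin_le_nhds, self_mem_nhdsWithin⟩
  have hlim : Tendsto (fun p : EuclideanSpace ℝ (Fin n) × ℝ =>
      ‖mollify φ u (x₀, p.2)‖ + |∑ i, C i| * ‖p.1 - x₀‖) (𝓝[{p | 0 ≤ p.2}] (x₀, 0)) (𝓝 0) := by
    have h1 : Tendsto (fun p : EuclideanSpace ℝ (Fin n) × ℝ => |∑ i, C i| * ‖p.1 - x₀‖)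
        (𝓝[{p | 0 ≤ p.2}] (x₀, 0)) (𝓝 0) := by
      have h2 : Continuous fun p : EuclideanSpace ℝ (Fin n) × ℝ =>
        |∑ i, C i| * ‖p.1 - x₀‖ := by fun_prop
      have h3 := (h2.tendsto (x₀, 0)).mono_left (nhdsWithin_le_nhds (s := {p | 0 ≤ p.2}))
      simpa using h3
    simpa using (hvert.comp hsnd).norm.add h1
  have hnear : ∀ᶠ p : EuclideanSpace ℝ (Fin n) × ℝ in 𝓝[{p | 0 ≤ p.2}] (x₀, 0),
      (∀ i, p.2 < δ i) ∧ p.1 ∈ Metric.ball x₀ 1 := by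
    refine nhdsWithin_le_nhds (Eventually.and (eventually_all.2 fun i => ?_) ?_)
    · exact (continuous_snd.tendsto (x₀, (0 : ℝ))).eventually (gt_mem_nhds (hδ i))
    · exact (continuous_fst.tendsto (x₀, (0 : ℝ))).eventually
        (Metric.ball_mem_nhds x₀ one_pos)
  refine squeeze_zero_norm' ?_ hlim
  filter_upwards [hnear, self_mem_nhdsWithin] with p hp1 (hp2 : 0 ≤ p.2)
  rcases hp2.eq_or_lt with h | h
  · rw [mollify_eq_zero_of_nonpos h0 h.symm.le]
    simp only [norm_zero]
    positivity
  · have hseg : ∀ z ∈ segment ℝ x₀ p.1, z ∈ Metric.closedBall 0 (‖x₀‖ + 1) := by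
      intro z hz
      have hz' := (convex_ball x₀ 1).segment_subset (Metric.mem_ball_self one_pos) hp1.2 hz
      rw [mem_ball_iff_norm] at hz'
      rw [mem_closedBall_zero_iff]
      calc ‖z‖ = ‖x₀ + (z - x₀)‖ := by rw [add_sub_cancel]
        _ ≤ ‖x₀‖ + ‖z - x₀‖ := norm_add_le _ _
        _ ≤ ‖x₀‖ + 1 := by gcongr
    have h1 := norm_mollify_sub_le hφ hu h fun i z hz => hC i z (hseg z hz) p.2 h (hp1.1 i)
    have h2 : ‖mollify φ u p‖ ≤ ‖mollify φ u (x₀, p.2)‖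
        + ‖mollify φ u (p.1, p.2) - mollify φ u (x₀, p.2)‖ := by
      calc ‖mollify φ u p‖ = ‖mollify φ u (x₀, p.2)
            + (mollify φ u (p.1, p.2) - mollify φ u (x₀, p.2))‖ := by rw [add_sub_cancel]
        _ ≤ _ := norm_add_le _ _
    have h3 : (∑ i, C i) * ‖p.1 - x₀‖ ≤ |∑ i, C i| * ‖p.1 - x₀‖ := by
      gcongr
      exact le_abs_self _
    linarith

end Boundary


/-! ### Euclidean radius and growth at infinity. -/

section Radius

variable {n : ℕ}

/-- The Euclidean norm `√(|x|² + y²)`. -/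
noncomputable def rad (p : EuclideanSpace ℝ (Fin n) × ℝ) : ℝ := ‖WithLp.toLp 2 p‖

theorem rad_nonneg (p : EuclideanSpace ℝ (Fin n) × ℝ) : 0 ≤ rad p := norm_nonneg _

theorem rad_sq (p : EuclideanSpace ℝ (Fin n) × ℝ) : rad p ^ 2 = ‖p.1‖ ^ 2 + p.2 ^ 2 := by
  rw [rad, WithLp.prod_norm_sq_eq_of_L2]
  simp

theorem continuous_rad : Continuous (rad (n := n)) :=
  (WithLp.prod_continuous_toLp 2 _ _).norm

theorem rad_mk_zero (x : EuclideanSpace ℝ (Fin n)) : rad (x, 0) = ‖x‖ := by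
  have h := rad_sq (x, (0 : ℝ))
  simp only [ne_eq, OfNat.ofNat_ne_zero, not_false_eq_true, zero_pow, add_zero] at h
  exact (pow_left_inj₀ (rad_nonneg _) (norm_nonneg _) two_ne_zero).1 h

theorem rad_zero_mk {y : ℝ} (hy : 0 ≤ y) : rad ((0 : EuclideanSpace ℝ (Fin n)), y) = y := by
  have h := rad_sq ((0 : EuclideanSpace ℝ (Fin n)), y)
  simp only [norm_zero, ne_eq, OfNat.ofNat_ne_zero, not_false_eq_true, zero_pow, zero_add] at h
  exact (pow_left_inj₀ (rad_nonneg _) hy two_ne_zero).1 h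

theorem rad_add_le (p q : EuclideanSpace ℝ (Fin n) × ℝ) : rad (p + q) ≤ rad p + rad q := by
  rw [rad, WithLp.toLp_add]
  exact norm_add_le _ _

theorem rad_sub_le (p q : EuclideanSpace ℝ (Fin n) × ℝ) : rad (p - q) ≤ rad p + rad q := by
  rw [rad, WithLp.toLp_sub]
  exact norm_sub_le _ _

theorem norm_fst_le_rad (p : EuclideanSpace ℝ (Fin n) × ℝ) : ‖p.1‖ ≤ rad p :=
  le_of_sq_le_sq (by rw [rad_sq]; nlinarith [sq_nonneg p.2]) (rad_nonneg _)

theorem abs_snd_le_rad (p : EuclideanSpace ℝ (Fin n) × ℝ) : |p.2| ≤ rad p :=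
  abs_le_of_sq_le_sq (by rw [rad_sq]; nlinarith [sq_nonneg ‖p.1‖]) (rad_nonneg _)

theorem isCompact_half_ball (R : ℝ) :
    IsCompact {p : EuclideanSpace ℝ (Fin n) × ℝ | 0 ≤ p.2 ∧ rad p ≤ R} := by
  refine Metric.isCompact_of_isClosed_isBounded
    ((isClosed_le continuous_const continuous_snd).inter
      (isClosed_le continuous_rad continuous_const))
    (Metric.isBounded_closedBall (x := (0 : EuclideanSpace ℝ (Fin n) × ℝ)) (r := R)
      |>.subset ?_)
  rintro q ⟨-, hq⟩
  rw [mem_closedBall_zero_iff, Prod.norm_def]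
  exact max_le ((norm_fst_le_rad q).trans hq) ((abs_snd_le_rad q).trans hq)

end Radius

/-- `|f(p)| = o(|p|^s)` at infinity in the upper half space. -/
def IsLittleRad {n : ℕ} (f : EuclideanSpace ℝ (Fin n) × ℝ → ℂ) (s : ℝ) : Prop :=
  ∀ ε > 0, ∃ R₀, ∀ p ∈ upper n, R₀ ≤ rad p → ‖f p‖ ≤ ε * rad p ^ s

/-- `|f(p)| ≤ C R^s` on half balls of radius `R ≥ 1`. -/
def IsBigRad {n : ℕ} (f : EuclideanSpace ℝ (Fin n) × ℝ → ℂ) (s : ℝ) : Prop :=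
  ∃ C, 0 ≤ C ∧ ∀ R, 1 ≤ R → ∀ p ∈ upper n, rad p ≤ R → ‖f p‖ ≤ C * R ^ s

theorem SupIsLittleO.isLittleRad {n : ℕ} {u : EuclideanSpace ℝ (Fin n) × ℝ → ℂ} {s : ℝ}
    (h : SupIsLittleO u s) : IsLittleRad u s := by
  intro ε hε
  have h1 := h.eventually (gt_mem_nhds (ENNReal.ofReal_pos.2 hε))
  obtain ⟨R₀, hR₀⟩ := eventually_atTop.1 h1
  refine ⟨max R₀ 1, fun p hp hpr => ?_⟩
  have hr : 0 < rad p := lt_of_lt_of_le one_pos ((le_max_right _ _).trans hpr)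
  have h2 := (hR₀ _ ((le_max_left _ _).trans hpr)).le
  have hpos : 0 < rad p ^ s := Real.rpow_pos_of_pos hr s
  rw [ENNReal.div_le_iff (ENNReal.ofReal_pos.2 hpos).ne' ENNReal.ofReal_ne_top,
    ← ENNReal.ofReal_mul hε.le] at h2
  have h3 : ‖u p‖ₑ ≤ supHemisphere u (rad p) :=
    le_iSup₂ (f := fun q (_ : q ∈ hemisphere n (rad p)) => ‖u q‖ₑ) p ⟨hp, (rad_sq p).symm⟩
  have h4 := h3.trans h2
  rwa [← ofReal_norm, ENNReal.ofReal_le_ofReal_iff (by positivity)] at h4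

section Growth

variable {n : ℕ} {φ : EuclideanSpace ℝ (Fin n) → ℝ} {u : EuclideanSpace ℝ (Fin n) × ℝ → ℂ}

theorem IsLittleRad.mollify {s : ℝ} (hs : 0 < s) (h : IsLittleRad u s) (hφ : IsTest φ) :
    IsLittleRad (mollify φ u) s := by
  intro ε hε
  obtain ⟨a, ha⟩ := hφ.supp.isBounded.subset_closedBall 0
  have hφi : Integrable fun t => ‖φ t‖ :=
    (hφ.continuous.integrable_of_hasCompactSupport hφ.supp).norm
  set A := ∫ t, ‖φ t‖ with hA
  have hA0 : 0 ≤ A := integral_nonneg fun t => norm_nonneg _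
  -- Shifts in the support of `φ` at most double a large radius, costing `2 ^ s`; integrating
  -- against `|φ|` costs `A`.
  obtain ⟨R₀, hR₀⟩ := h (ε / ((A + 1) * 2 ^ s)) (by positivity)
  refine ⟨max |R₀| 0 + |a|, fun p hp hpr => ?_⟩
  have hap : |a| ≤ rad p := by linarith [le_max_right |R₀| 0]
  have hpw : ∀ t, ‖φ t • u (p - (t, (0 : ℝ)))‖ ≤
      ‖φ t‖ * (ε / ((A + 1) * 2 ^ s) * (2 * rad p) ^ s) := by
    intro t
    rw [norm_smul]
    by_cases ht : t ∈ tsupport φ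
    · gcongr
      have h1 : ‖t‖ ≤ |a| := (mem_closedBall_zero_iff.1 (ha ht)).trans (le_abs_self a)
      have h2 : rad (p - (t, (0 : ℝ))) ≤ 2 * rad p := by
        have := rad_sub_le p (t, (0 : ℝ))
        rw [rad_mk_zero] at this
        linarith
      have h3 : R₀ ≤ rad (p - (t, (0 : ℝ))) := by
        have := rad_add_le (p - (t, (0 : ℝ))) (t, (0 : ℝ))
        rw [rad_mk_zero, sub_add_cancel] at this
        linarith [le_max_left |R₀| 0, le_abs_self R₀]
      refine (hR₀ _ (sub_mem_upper hp t) h3).trans ?_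
      gcongr
      exact rad_nonneg _
    · rw [image_eq_zero_of_notMem_tsupport ht]
      simp
  calc ‖HalfSpace.mollify φ u p‖ ≤ ∫ t, ‖φ t‖ * (ε / ((A + 1) * 2 ^ s) * (2 * rad p) ^ s) :=
        norm_integral_le_of_norm_le (hφi.mul_const _) (Eventually.of_forall hpw)
    _ = A * (ε / ((A + 1) * 2 ^ s) * (2 * rad p) ^ s) := by rw [integral_mul_const]
    _ = A / (A + 1) * (ε * rad p ^ s) := by
        rw [Real.mul_rpow zero_le_two (rad_nonneg p)]
        field_simp
    _ ≤ 1 * (ε * rad p ^ s) := by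
        have := Real.rpow_nonneg (rad_nonneg p) s
        gcongr
        rw [div_le_one (by positivity)]
        linarith
    _ = ε * rad p ^ s := one_mul _

theorem IsLittleRad.isBigRad {f : EuclideanSpace ℝ (Fin n) × ℝ → ℂ} {s : ℝ} (hs : 0 < s)
    (h : IsLittleRad f s) (hc : ContinuousOn f {p | 0 ≤ p.2}) : IsBigRad f s := by
  obtain ⟨R₀, hR₀⟩ := h 1 one_pos
  obtain ⟨B, hB⟩ := (isCompact_half_ball (n := n) R₀).exists_bound_of_continuousOn
    (hc.mono fun q hq => hq.1)
  refine ⟨|B| + 1, by positivity, fun R hR p hp hpR => ?_⟩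
  have hRs : 1 ≤ R ^ s := Real.one_le_rpow hR hs.le
  rcases le_total (rad p) R₀ with h1 | h1
  · calc ‖f p‖ ≤ B := hB p ⟨le_of_lt hp, h1⟩
      _ ≤ |B| + 1 := by linarith [le_abs_self B]
      _ ≤ (|B| + 1) * R ^ s := le_mul_of_one_le_right (by positivity) hRs
  · calc ‖f p‖ ≤ 1 * rad p ^ s := hR₀ p hp h1
      _ ≤ (|B| + 1) * R ^ s := by
        have := rad_nonneg p
        gcongr
        linarith [abs_nonneg B]

end Growth

/-! ### Decay of tangential derivatives and the Liouville argument. -/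

/-- A solution in the upper half space with continuous partial derivatives, extended by zero,
whose slices tend to zero at the boundary in the sense of distributions. -/
structure VanishingSolution {n : ℕ} (α : ℝ) (u : EuclideanSpace ℝ (Fin n) × ℝ → ℂ)
    (ux uxx : Fin n → EuclideanSpace ℝ (Fin n) × ℝ → ℂ)
    (uy uyy : EuclideanSpace ℝ (Fin n) × ℝ → ℂ) : Prop where
  solves : SolvesWith α u ux uxx uy uyy
  cont : ContinuousOn u (upper n)
  contX : ∀ i, ContinuousOn (ux i) (upper n)
  contXX : ∀ i, ContinuousOn (uxx i) (upper n)
  contY : ContinuousOn uy (upper n)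
  contYY : ContinuousOn uyy (upper n)
  zero_below : ∀ p : EuclideanSpace ℝ (Fin n) × ℝ, p.2 ≤ 0 → u p = 0
  boundary : TestsToZero u

namespace VanishingSolution

variable {n : ℕ} {α : ℝ} {u : EuclideanSpace ℝ (Fin n) × ℝ → ℂ}
  {ux uxx : Fin n → EuclideanSpace ℝ (Fin n) × ℝ → ℂ}
  {uy uyy : EuclideanSpace ℝ (Fin n) × ℝ → ℂ} {φ : EuclideanSpace ℝ (Fin n) → ℝ}

theorem solves_mollify (h : VanishingSolution α u ux uxx uy uyy) (hφ : IsTest φ) :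
    SolvesWith α (mollify φ u) (fun i => mollify φ (ux i)) (fun i => mollify φ (uxx i))
      (mollify φ uy) (mollify φ uyy) :=
  h.solves.mollify hφ h.cont h.contX h.contXX h.contY h.contYY

theorem mollify_ux (h : VanishingSolution α u ux uxx uy uyy) (hφ : IsTest φ) (i : Fin n)
    {p : EuclideanSpace ℝ (Fin n) × ℝ} (hp : p ∈ upper n) :
    mollify φ (ux i) p = mollify (testDeriv (EuclideanSpace.single i 1) φ) u p :=
  HasDerivAt.unique (((h.solves_mollify hφ).hx i).fst p hp)
    (hasLineDerivAt_mollify_testDeriv hφ h.cont (EuclideanSpace.single i 1) hp)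

theorem continuousOn_closed (h : VanishingSolution α u ux uxx uy uyy) (hφ : IsTest φ) :
    ContinuousOn (mollify φ u) {p | 0 ≤ p.2} :=
  continuousOn_mollify_closed hφ h.cont h.boundary h.zero_below

/-- A tangential derivative of a mollified solution gains one power of decay. -/
theorem isBigRad_testDeriv (h : VanishingSolution α u ux uxx uy uyy) (hn : 1 ≤ n)
    (hφ : IsTest φ) (i : Fin n) {s : ℝ} (hs : IsBigRad (mollify φ u) s) :
    IsBigRad (mollify (testDeriv (EuclideanSpace.single i 1) φ) u) (s - 1) := by
  obtain ⟨C, hC0, hC⟩ := hs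
  set φ' := testDeriv (EuclideanSpace.single i 1) φ with hφ'def
  have hφ' : IsTest φ' := hφ.testDeriv _
  have hz : ∀ ψ : EuclideanSpace ℝ (Fin n) → ℝ, ∀ x, mollify ψ u (x, 0) = 0 := fun ψ x =>
    mollify_eq_zero_of_nonpos h.zero_below le_rfl
  set G := Real.sqrt (gradConst n α) with hG
  have hG2 : G ^ 2 = gradConst n α := Real.sq_sqrt (gradConst_pos n α).le
  have hG0 : 0 ≤ G := Real.sqrt_nonneg _
  -- The maximum principle is real, so real and imaginary parts are treated separately through `l`.
  have key : ∀ l : ℂ →L[ℝ] ℝ, (∀ z, |l z| ≤ ‖z‖) → ∀ R, 1 ≤ R → ∀ p ∈ upper n, rad p ≤ R →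
      |l (mollify φ' u p)| ≤ G * (C * (3 * R) ^ s) / R := by
    intro l hl R hR p hp hpR
    have hR0 : 0 < R := by linarith
    have hM0 : 0 ≤ C * (3 * R) ^ s := mul_nonneg hC0 (Real.rpow_nonneg (by linarith) _)
    have hp2 : p.2 ^ 2 ≤ R ^ 2 := by
      rw [← sq_abs]
      exact pow_le_pow_left₀ (abs_nonneg _) ((abs_snd_le_rad p).trans hpR) 2
    have hη : 1 / (4 * R ^ 2) * (‖p.1 - p.1‖ ^ 2 + p.2 ^ 2) ≤ 1 / 4 := by
      rw [sub_self, norm_zero, div_mul_eq_mul_div, div_le_iff₀ (by positivity)]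
      linarith
    -- The choice `1 / (4R²)` is the half ball of radius `2R` about the foot `(p.1, 0)`. It lies
    -- within radius `3R` of the origin, and the cutoff is at least `3/4` at `p`.
    have hb := bernstein_estimate hn i
      ((h.solves_mollify hφ).clm_comp l) ((h.solves_mollify hφ').clm_comp l)
      (fun q hq => by rw [h.mollify_ux hφ i hq])
      (l.continuous.comp_continuousOn (h.continuousOn_closed hφ))
      (l.continuous.comp_continuousOn (h.continuousOn_closed hφ'))
      (fun x => by rw [hz, map_zero]) (fun x => by rw [hz, map_zero]) p.1
      (s := 1 / (4 * R ^ 2)) (M := C * (3 * R) ^ s) (by positivity)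
      (fun q hq0 hq => by
        refine (hl _).trans (hC (3 * R) (by linarith) q hq0 ?_)
        rw [div_mul_eq_mul_div, one_mul, div_le_one (by positivity)] at hq
        have h1 : rad (q - (p.1, (0 : ℝ))) ≤ 2 * R := by
          refine le_of_sq_le_sq ?_ (by linarith)
          rw [rad_sq]
          simp only [Prod.fst_sub, Prod.snd_sub, sub_zero]
          linarith
        have h2 := rad_add_le (q - (p.1, (0 : ℝ))) (p.1, (0 : ℝ))
        rw [sub_add_cancel, rad_mk_zero] at h2
        linarith [norm_fst_le_rad p])
      hp (by linarith)
    set η := 1 - 1 / (4 * R ^ 2) * (‖p.1 - p.1‖ ^ 2 + p.2 ^ 2) with hηdef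
    have hη' : 1 / 2 ≤ η := by linarith
    set g := l (mollify φ' u p) with hg
    have h3 : (η * |g|) ^ 2 ≤ (G * (C * (3 * R) ^ s) / (2 * R)) ^ 2 := by
      calc (η * |g|) ^ 2 = (η * g) ^ 2 := by rw [mul_pow, sq_abs, mul_pow]
        _ ≤ gradConst n α * (1 / (4 * R ^ 2)) * (C * (3 * R) ^ s) ^ 2 := hb
        _ = _ := by
          rw [← hG2]
          field_simp
          ring
    have h4 := le_of_sq_le_sq h3 (by positivity)
    have h5 : G * (C * (3 * R) ^ s) / (2 * R) = 1 / 2 * (G * (C * (3 * R) ^ s) / R) := by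
      field_simp
    have h6 : 1 / 2 * |g| ≤ η * |g| := by gcongr
    linarith
  refine ⟨2 * (G * (C * 3 ^ s)), by positivity, fun R hR p hp hpR => ?_⟩
  have hR0 : 0 < R := by linarith
  have hre := key Complex.reCLM (fun z => Complex.abs_re_le_norm z) R hR p hp hpR
  have him := key Complex.imCLM (fun z => Complex.abs_im_le_norm z) R hR p hp hpR
  simp only [Complex.reCLM_apply, Complex.imCLM_apply] at hre him
  have h1 := Complex.norm_le_abs_re_add_abs_im (mollify φ' u p)
  have h2 : G * (C * (3 * R) ^ s) / R = G * (C * 3 ^ s) * R ^ (s - 1) := by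
    rw [Real.mul_rpow (by norm_num) hR0.le, Real.rpow_sub_one hR0.ne']
    ring
  rw [h2] at hre him
  linarith

/-- Iterated coordinate derivatives of a test function. -/
noncomputable def iterDeriv (l : List (Fin n)) (φ : EuclideanSpace ℝ (Fin n) → ℝ) :
    EuclideanSpace ℝ (Fin n) → ℝ :=
  l.foldr (fun i ψ => testDeriv (EuclideanSpace.single i 1) ψ) φ

theorem isTest_iterDeriv (hφ : IsTest φ) (l : List (Fin n)) : IsTest (iterDeriv l φ) := by
  induction l with
  | nil => exact hφ
  | cons i l ih => exact ih.testDeriv _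

theorem isBigRad_iterDeriv (h : VanishingSolution α u ux uxx uy uyy) (hn : 1 ≤ n)
    (hφ : IsTest φ) {s : ℝ} (hs : IsBigRad (mollify φ u) s) (l : List (Fin n)) :
    IsBigRad (mollify (iterDeriv l φ) u) (s - l.length) := by
  induction l with
  | nil => simpa [iterDeriv] using hs
  | cons i l ih =>
    have := h.isBigRad_testDeriv hn (isTest_iterDeriv hφ l) i ih
    rwa [show s - (i :: l).length = s - l.length - 1 by
      rw [List.length_cons]
      push_cast
      ring]

/-- For fixed `p` the bound holds with every `R ≥ max 1 (rad p)`, so `R` may tend to infinity. -/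
theorem _root_.HalfSpace.IsBigRad.eq_zero {f : EuclideanSpace ℝ (Fin n) × ℝ → ℂ} {s : ℝ}
    (hf : IsBigRad f s) (hs : s < 0) : ∀ p ∈ upper n, f p = 0 := by
  obtain ⟨C, -, hC⟩ := hf
  intro p hp
  have h1 : Tendsto (fun R : ℝ => C * R ^ s) atTop (𝓝 0) := by
    simpa using (tendsto_rpow_neg_atTop (neg_pos.2 hs)).const_mul C
  have h2 : ‖f p‖ ≤ 0 := ge_of_tendsto h1 (by
    filter_upwards [eventually_ge_atTop 1, eventually_ge_atTop (rad p)] with R h1 h2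
    exact hC R h1 p hp h2)
  exact norm_le_zero_iff.1 h2

/-- A solution depending on `y` only, vanishing at the boundary and `o(r^(α+1))`, is zero. -/
theorem mollify_eq_zero_of_testDeriv (h : VanishingSolution α u ux uxx uy uyy) (hα : -1 < α)
    (hφ : IsTest φ) (hg : IsLittleRad (mollify φ u) (α + 1))
    (hd : ∀ i, ∀ p ∈ upper n, mollify (testDeriv (EuclideanSpace.single i 1) φ) u p = 0) :
    ∀ p ∈ upper n, mollify φ u p = 0 := by
  have hsol := h.solves_mollify hφ
  have hβ : 0 < α + 1 := by linarith
  have hux : ∀ i, ∀ p ∈ upper n, mollify φ (ux i) p = 0 := fun i p hp => by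
    rw [h.mollify_ux hφ i hp, hd i p hp]
  have huxx : ∀ i, ∀ p ∈ upper n, mollify φ (uxx i) p = 0 := by
    intro i p hp
    have h1 := (hsol.hx i).snd p hp
    have h2 : HasLineDerivAt ℝ (fun _ : EuclideanSpace ℝ (Fin n) × ℝ => (0 : ℂ))
        (mollify φ (uxx i) p) p (dirX i) :=
      h1.congr_of_eventuallyEq (by
        filter_upwards [(isOpen_upper n).mem_nhds hp] with q hq
        exact (hux i q hq).symm)
    exact HasDerivAt.unique h2 (hasDerivAt_const _ _)
  have hline : ∀ {f f' : EuclideanSpace ℝ (Fin n) × ℝ → ℂ},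
      (∀ p ∈ upper n, HasLineDerivAt ℝ f (f' p) p (dirY n)) → ∀ y : ℝ, 0 < y →
      HasDerivAt (fun y => f ((0 : EuclideanSpace ℝ (Fin n)), y)) (f' (0, y)) y := by
    intro f f' hf y hy
    have h1 : HasDerivAt (fun r : ℝ => f (((0 : EuclideanSpace ℝ (Fin n)), y) + r • dirY n))
        (f' (0, y)) (y - y) := by
      rw [sub_self]
      exact hf _ hy
    refine (HasDerivAt.comp_sub_const y y h1).congr_of_eventuallyEq
      (Eventually.of_forall fun r => ?_)
    simp [dirY]
  have hv := hline hsol.hy.fst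
  have hv' := hline hsol.hy.snd
  set v := fun y : ℝ => mollify φ u ((0 : EuclideanSpace ℝ (Fin n)), y) with hvdef
  set w := fun y : ℝ => mollify φ uy ((0 : EuclideanSpace ℝ (Fin n)), y) with hwdef
  have hode : ∀ y : ℝ, 0 < y →
      mollify φ uyy ((0 : EuclideanSpace ℝ (Fin n)), y) = (α / y) • w y := by
    intro y hy
    have h1 := hsol.eq_zero ((0 : EuclideanSpace ℝ (Fin n)), y) hy
    rw [Finset.sum_eq_zero fun i _ => huxx i _ hy, zero_add] at h1
    exact sub_eq_zero.1 h1
  have hconst : ∀ {g : ℝ → ℂ}, (∀ y, 0 < y → HasDerivAt g 0 y) →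
      ∃ c, ∀ y, 0 < y → g y = c := fun {g} hg => ⟨g 1, fun y hy =>
    (convex_Ioi (0 : ℝ)).is_const_of_fderivWithin_eq_zero (𝕜 := ℝ)
      (fun z hz => (hg z hz).differentiableAt.differentiableWithinAt)
      (fun z hz => by
        rw [fderivWithin_of_isOpen isOpen_Ioi hz]
        ext
        simpa using (hg z hz).deriv) hy (Set.mem_Ioi.2 one_pos)⟩
  -- Integrating factor for `w' = (α/y) w`.
  obtain ⟨c, hc⟩ := hconst (g := fun y => y ^ (-α) • w y) fun y hy => by
    have h1 := (Real.hasDerivAt_rpow_const (p := -α) (Or.inl hy.ne')).smul (hv' y hy)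
    refine h1.congr_deriv ?_
    rw [hode y hy, smul_smul, ← add_smul, Real.rpow_sub_one hy.ne']
    convert zero_smul ℝ (w y) using 2
    ring
  have hw : ∀ y, 0 < y → w y = y ^ α • c := fun y hy => by
    rw [← hc y hy, smul_smul, ← Real.rpow_add hy, add_neg_cancel, Real.rpow_zero, one_smul]
  obtain ⟨d, hd'⟩ := hconst (g := fun y => v y - (y ^ (α + 1) / (α + 1)) • c) fun y hy => by
    have h1 := (hv y hy).sub
      (((Real.hasDerivAt_rpow_const (p := α + 1) (Or.inl hy.ne')).div_const
        (α + 1)).smul_const c)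
    refine h1.congr_deriv ?_
    change w y - _ = 0
    rw [hw y hy, add_sub_cancel_right, mul_div_cancel_left₀ _ hβ.ne', sub_self]
  have hd0 : d = 0 := by
    have h1 : Tendsto v (𝓝[>] 0) (𝓝 0) := tendsto_mollify_boundary h.boundary hφ 0
    have h2 : Tendsto (fun y : ℝ => (y ^ (α + 1) / (α + 1)) • c) (𝓝[>] 0) (𝓝 0) := by
      have h3 : ContinuousAt (fun y : ℝ => (y ^ (α + 1) / (α + 1)) • c) 0 :=
        ((Real.continuousAt_rpow_const 0 (α + 1) (Or.inr hβ.le)).div_const _).smul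
          continuousAt_const
      have h4 := h3.tendsto.mono_left (nhdsWithin_le_nhds (s := Set.Ioi 0))
      simpa [Real.zero_rpow hβ.ne'] using h4
    have h3 := h1.sub h2
    rw [sub_zero] at h3
    refine tendsto_nhds_unique (tendsto_const_nhds.congr' ?_) h3
    filter_upwards [self_mem_nhdsWithin] with y hy
    exact (hd' y hy).symm
  have hveq : ∀ y, 0 < y → v y = (y ^ (α + 1) / (α + 1)) • c := fun y hy => by
    have := hd' y hy
    rw [hd0] at this
    exact sub_eq_zero.1 this
  have hc0 : c = 0 := by
    refine norm_le_zero_iff.1 (le_of_forall_pos_le_add fun ε hε => ?_)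
    -- Dividing `ε` by `α + 1` matches the denominator in `v`, so one far point on the vertical axis
    -- gives `‖c‖ ≤ ε`.
    obtain ⟨R₀, hR₀⟩ := hg (ε / (α + 1)) (by positivity)
    have hy : (0 : ℝ) < max R₀ 1 := lt_of_lt_of_le one_pos (le_max_right _ _)
    have h1 := hR₀ ((0 : EuclideanSpace ℝ (Fin n)), max R₀ 1) hy (by
      rw [rad_zero_mk hy.le]
      exact le_max_left _ _)
    rw [rad_zero_mk hy.le] at h1
    change ‖v (max R₀ 1)‖ ≤ _ at h1
    have hpow := Real.rpow_pos_of_pos hy (α + 1)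
    rw [hveq _ hy, norm_smul, Real.norm_of_nonneg (by positivity)] at h1
    rw [zero_add]
    have h2 : max R₀ 1 ^ (α + 1) / (α + 1) * ‖c‖ ≤ max R₀ 1 ^ (α + 1) / (α + 1) * ε := by
      calc _ ≤ _ := h1
        _ = _ := by ring
    exact le_of_mul_le_mul_left h2 (by positivity)
  rintro ⟨x, y⟩ (hp : 0 < y)
  have h1 := norm_mollify_sub_le hφ h.cont hp (x₀ := 0) (x := x) (C := fun _ => 0)
    fun i z _ => by rw [hd i (z, y) hp, norm_zero]
  have h2 : v y = 0 := by rw [hveq y hp, hc0, smul_zero]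
  rw [Finset.sum_const_zero, zero_mul, norm_le_zero_iff, sub_eq_zero] at h1
  exact h1.trans h2

theorem mollify_eq_zero (h : VanishingSolution α u ux uxx uy uyy) (hn : 1 ≤ n) (hα : -1 < α)
    (hg : IsLittleRad u (α + 1)) (hφ : IsTest φ) : ∀ p ∈ upper n, mollify φ u p = 0 := by
  have hβ : 0 < α + 1 := by linarith
  obtain ⟨N, hN⟩ := exists_nat_gt (α + 1)
  -- Order `N` vanishes by decay with negative exponent `α + 1 - N`. Below it, each iterated
  -- derivative of `φ` is itself a test function whose first derivatives were already handled.
  have hdesc : ∀ k ≤ N, ∀ l : List (Fin n), l.length = N - k →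
      ∀ p ∈ upper n, mollify (iterDeriv l φ) u p = 0 := by
    intro k
    induction k with
    | zero =>
      intro _ l hl
      refine (h.isBigRad_iterDeriv hn hφ
        ((hg.mollify hβ hφ).isBigRad hβ (h.continuousOn_closed hφ)) l).eq_zero ?_
      rw [hl]
      simpa using hN
    | succ k ih =>
      intro hk l hl
      have hl' := isTest_iterDeriv hφ l
      refine h.mollify_eq_zero_of_testDeriv hα hl' (hg.mollify hβ hl') fun i => ?_
      exact ih (by omega) (i :: l) (by rw [List.length_cons]; omega)
  exact hdesc N le_rfl [] (by simp)

theorem eq_zero (h : VanishingSolution α u ux uxx uy uyy) (hn : 1 ≤ n) (hα : -1 < α)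
    (hg : IsLittleRad u (α + 1)) : ∀ p ∈ upper n, u p = 0 := by
  rintro ⟨x, y⟩ (hp : 0 < y)
  have hc := continuous_slice h.cont hp
  have hae := ae_eq_zero_of_integral_contDiff_smul_eq_zero (μ := volume) hc.locallyIntegrable
    fun ψ hψ hψs => by
      -- Mollifying with the reflected `ψ` and evaluating at `x = 0` gives the plain integral of `ψ`
      -- against the slice.
      have hψt : IsTest fun t => ψ (0 - t) := IsTest.comp_sub_left ⟨hψ, hψs⟩ 0
      have h1 := h.mollify_eq_zero hn hα hg hψt ((0 : EuclideanSpace ℝ (Fin n)), y) hp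
      rw [mollify_eq_integral_sub] at h1
      simpa using h1
  exact congrFun ((hc.ae_eq_iff_eq volume continuous_const).1 hae) x

end VanishingSolution

/-! ### From classical solutions to the mollification setting. -/

theorem hasTwoLineDerivs_of_contDiffOn {n : ℕ} {u : EuclideanSpace ℝ (Fin n) × ℝ → ℂ}
    (hu : ContDiffOn ℝ 2 u (upper n)) (v : EuclideanSpace ℝ (Fin n) × ℝ) :
    HasTwoLineDerivs (upper n) v u (fun p => lineDeriv ℝ u p v)
        (fun p => lineDeriv ℝ (fun q => lineDeriv ℝ u q v) p v) ∧
      ContinuousOn (fun p => lineDeriv ℝ u p v) (upper n) ∧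
      ContinuousOn (fun p => lineDeriv ℝ (fun q => lineDeriv ℝ u q v) p v) (upper n) := by
  have step : ∀ {m k : ℕ} {f : EuclideanSpace ℝ (Fin n) × ℝ → ℂ}, m + 1 ≤ k →
      ContDiffOn ℝ k f (upper n) → ContDiffOn ℝ m (fun p => lineDeriv ℝ f p v) (upper n) ∧
        ∀ p ∈ upper n, HasLineDerivAt ℝ f (lineDeriv ℝ f p v) p v := by
    intro m k f hmk hf
    have hd : ∀ p ∈ upper n, DifferentiableAt ℝ f p := fun p hp =>
      (hf.contDiffAt ((isOpen_upper n).mem_nhds hp)).differentiableAt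
        (by exact_mod_cast (by omega : k ≠ 0))
    refine ⟨?_, fun p hp => (hd p hp).lineDifferentiableAt.hasLineDerivAt⟩
    exact ((hf.fderiv_of_isOpen (isOpen_upper n) (m := m)
      (by exact_mod_cast hmk)).clm_apply contDiffOn_const).congr
      fun p hp => (hd p hp).lineDeriv_eq_fderiv
  have h1 := step (m := 1) (k := 2) le_rfl hu
  have h2 := step (m := 0) (k := 1) le_rfl h1.1
  exact ⟨⟨h1.2, h2.2⟩, h1.1.continuousOn, h2.1.continuousOn⟩

theorem IsSolution.vanishingSolution {n : ℕ} {α : ℝ} {u : EuclideanSpace ℝ (Fin n) × ℝ → ℂ}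
    (hu : IsSolution α u) (hb : HasBoundaryLimit u 0) :
    VanishingSolution α ((upper n).indicator u) (fun i => partialX i u)
      (fun i => partialX i (partialX i u)) (partialY u) (partialY (partialY u)) := by
  have hx := fun i => hasTwoLineDerivs_of_contDiffOn hu.1 (dirX i)
  have hy := hasTwoLineDerivs_of_contDiffOn hu.1 (dirY n)
  have hcongr : ∀ {v f f' f''}, HasTwoLineDerivs (upper n) v f f' f'' →
      HasTwoLineDerivs (F := ℂ) (upper n) v ((upper n).indicator f) f' f'' := by
    intro v f f' f'' hf
    refine ⟨fun p hp => (hf.fst p hp).congr_of_eventuallyEq ?_, hf.snd⟩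
    filter_upwards [(isOpen_upper n).mem_nhds hp] with q hq
    exact Set.indicator_of_mem hq f
  refine ⟨⟨fun i => hcongr (hx i).1, hcongr hy.1, fun p hp => ?_⟩,
    hu.1.continuousOn.congr fun p hp => Set.indicator_of_mem hp u, fun i => (hx i).2.1,
    fun i => (hx i).2.2, hy.2.1, hy.2.2,
    fun p hp => Set.indicator_of_notMem (s := upper n) (not_lt.2 hp) u, ?_⟩
  · have h1 := hu.2 p hp
    -- The weight `y^(-α)` is nonzero and drops out.
    rw [opD, mul_eq_zero] at h1
    rw [Complex.real_smul]
    refine h1.resolve_left ?_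
    exact_mod_cast (Real.rpow_pos_of_pos hp (-α)).ne'
  · intro ψ hψ
    refine (hb.testsToZero ψ hψ).congr' ?_
    filter_upwards [self_mem_nhdsWithin] with y (hy : 0 < y)
    congr 1 with x
    rw [Set.indicator_of_mem (show (x, y) ∈ upper n from hy)]

end HalfSpace

theorem corollary5p4 (n : ℕ) (hn : 1 ≤ n) (α : ℝ) (hα : -1 < α)
    (u : EuclideanSpace ℝ (Fin n) × ℝ → ℂ)
    (hu : HalfSpace.IsSolution α u)
    (hgrowth : HalfSpace.SupIsLittleO u (α + 1))
    (hlim : HalfSpace.HasBoundaryLimit u 0) :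
    ∀ p ∈ HalfSpace.upper n, u p = 0 := by
  intro p hp
  have hlittle : HalfSpace.IsLittleRad ((HalfSpace.upper n).indicator u) (α + 1) := by
    intro ε hε
    obtain ⟨R₀, hR₀⟩ := hgrowth.isLittleRad ε hε
    exact ⟨R₀, fun q hq hqr => by
      rw [Set.indicator_of_mem hq]
      exact hR₀ q hq hqr⟩
  rw [← Set.indicator_of_mem hp u]
  exact (hu.vanishingSolution hlim).eq_zero hn hα hlittle p hp
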